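/- Let $(K,v)$ be a henselian valued field (i.e. $v$ extends uniquely to an algebraic closure $\overline K$; write $\bar v$ for this extension), and let $\mu$ be a valuation on $K[x]$ extending $v$. Valuations are written additively, may take the value $\infty$ on a prime ideal (the support), and all take values in $\Lambda\cup\{\infty\}$ for a common divisible ordered abelian group $\Lambda$. Valuations are compared pointwise: $\mu<\eta$ means $\mu(f)\le\eta(f)$ for all $f\in K[x]$ and $\mu\neq\eta$. Let $\mathcal G_\mu=\bigoplus_\alpha \mathcal P_\alpha/\mathcal P_\alpha^+$, where $\mathcal P_\alpha=\{f:\mu(f)\ge\alpha\}$ and $\mathcal P^+_\alpha=\{f:\mu(f)>\alpha\}$, and for $\mu(f)\ne\infty$ let $\mathrm{in}_\mu f$ be the class of $f$ in $\mathcal P_{\mu(f)}/\mathcal P^+_{\mu(f)}$; write $f\sim_\mu g$ if $\mathrm{in}_\mu f=\mathrm{in}_\mu g$. A *key polynomial* for $\mu$ is a monic $\phi$ with $\mu(\phi)\neq\infty$ such that $\mathrm{in}_\mu\phi$ is not a unit of $\mathcal G_\mu$, such that $\mathrm{in}_\mu\phi\mid\mathrm{in}_\mu(fg)$ implies $\mathrm{in}_\mu\phi\mid\mathrm{in}_\mu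 f$ or $\mathrm{in}_\mu\phi\mid\mathrm{in}_\mu g$, and such that $\mathrm{in}_\mu\phi\mid\mathrm{in}_\mu f$ with $f\ne0$ implies $\deg\phi\le\deg f$. Let $[\phi]_\mu$ be the set of key polynomials $\psi$ for $\mu$ with $\psi\sim_\mu\phi$. For $\mu<\eta$, the tangent direction $\mathbf t(\mu,\eta)$ is the set of monic polynomials $\phi$ of minimal degree satisfying $\mu(\phi)<\eta(\phi)$. For $F\in K[x]$ monic irreducible with root $\theta\in\overline K$, put $v_F(f)=\bar v(f(\theta))$ for $f\in K[x]$. For a key polynomial $\phi$ for $\mu$ and $g\in K[x]$ with $\phi$-expansion $g=\sum_n a_n\phi^n$ ($\deg a_n<\deg\phi$), the Newton polygon $N_{\mu,\phi}(g)\subset\mathbb Q\times\Lambda$ is the lower convex hull of $\{(n,\mu(a_n)) : a_n\ne0\}$; its length $\ell(N_{\mu,\phi}(g))$ is the abscissa of its right endpoint. It is *one-sided of slope* $-\lambda$ (where $\lambda\in\Lambda$) if $\alpha+n\lambda$ is constant on the points $(n,\alpha)$ of the polygon, its left endpoint has abscissa $0$ and its right endpoint has positive abscissa. **Theorem.** Let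 $Q$ be a key polynomial for $\mu$ and let $F\in K[x]$ be monic and irreducible. Then $$\mathrm{in}_\mu Q\mid \mathrm{in}_\mu F\iff \mu<v_F\ \text{ and }\ \mathbf t(\mu,v_F)=[Q]_\mu .$$ Moreover, if these conditions hold, then: (i) either $F=Q$, or the Newton polygon $N_{\mu,Q}(F)$ is one-sided of slope $-v_F(Q)$ (in particular $v_F(Q)<\infty$); (ii) $F\sim_\mu Q^\ell$, with $\ell=\ell(N_{\mu,Q}(F))=\deg(F)/\deg(Q)$. -/

import Mathlib

open Polynomial
open scoped DirectSum

noncomputable section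

namespace ValPoly

section GradedAlgebra

variable {A : Type*} [CommRing A]
variable {Λ : Type*} [AddCommGroup Λ] [LinearOrder Λ] [IsOrderedAddMonoid Λ]

/-- `𝒫_α = {f | μ f ≥ α}`. -/
def geSubgroup (μ : AddValuation A (WithTop Λ)) (α : Λ) : AddSubgroup A where
  carrier := {f | (α : WithTop Λ) ≤ μ f}
  zero_mem' := by simp
  add_mem' := fun ha hb => μ.map_le_add ha hb
  neg_mem' := fun {x} hx => by
    have hx' : (α : WithTop Λ) ≤ μ x := hx
    change (α : WithTop Λ) ≤ μ (-x)
    rwa [AddValuation.map_neg]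

/-- `𝒫_α⁺ = {f | μ f > α}`. -/
def gtSubgroup (μ : AddValuation A (WithTop Λ)) (α : Λ) : AddSubgroup A where
  carrier := {f | (α : WithTop Λ) < μ f}
  zero_mem' := by simp
  add_mem' := fun ha hb => μ.map_lt_add ha hb
  neg_mem' := fun {x} hx => by
    have hx' : (α : WithTop Λ) < μ x := hx
    change (α : WithTop Λ) < μ (-x)
    rwa [AddValuation.map_neg]

/-- The homogeneous component `𝒫_α / 𝒫_α⁺`. It is zero unless `α` is the value of some element. -/
abbrev GrComponent (μ : AddValuation A (WithTop Λ)) (α : Λ) : Type _ :=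
  geSubgroup μ α ⧸ (gtSubgroup μ α).addSubgroupOf (geSubgroup μ α)

/-- The class in `𝒫_α / 𝒫_α⁺` of an element of `𝒫_α`. -/
def grMk (μ : AddValuation A (WithTop Λ)) (α : Λ) (f : A) (hf : (α : WithTop Λ) ≤ μ f) :
    GrComponent μ α :=
  QuotientAddGroup.mk (⟨f, hf⟩ : geSubgroup μ α)

variable {μ : AddValuation A (WithTop Λ)}

theorem grMk_eq_iff {α : Λ} {f g : A} (hf : (α : WithTop Λ) ≤ μ f) (hg : (α : WithTop Λ) ≤ μ g) :
    grMk μ α f hf = grMk μ α g hg ↔ (α : WithTop Λ) < μ (-f + g) := by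
  unfold grMk
  rw [QuotientAddGroup.eq, AddSubgroup.mem_addSubgroupOf]
  rfl

theorem grMk_surj {α : Λ} (a : GrComponent μ α) : ∃ f hf, a = grMk μ α f hf := by
  induction a using QuotientAddGroup.induction_on with
  | H z => exact ⟨z.1, z.2, rfl⟩

theorem le_map_mul {α β : Λ} {f g : A} (hf : (α : WithTop Λ) ≤ μ f)
    (hg : (β : WithTop Λ) ≤ μ g) : ((α + β : Λ) : WithTop Λ) ≤ μ (f * g) := by
  rw [μ.map_mul, WithTop.coe_add]
  exact add_le_add hf hg

theorem lt_map_mul_left {α β : Λ} {f g : A} (hf : (α : WithTop Λ) < μ f)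
    (hg : (β : WithTop Λ) ≤ μ g) : ((α + β : Λ) : WithTop Λ) < μ (f * g) := by
  rw [μ.map_mul, WithTop.coe_add]
  exact WithTop.add_lt_add_of_lt_of_le WithTop.coe_ne_top hf hg

/-- Multiplication `𝒫_α / 𝒫_α⁺ × 𝒫_β / 𝒫_β⁺ → 𝒫_{α+β} / 𝒫_{α+β}⁺`, induced by that of the ring. -/
def grMul {α β : Λ} (a : GrComponent μ α) (b : GrComponent μ β) : GrComponent μ (α + β) :=
  Quotient.liftOn₂' a b (fun f g => grMk μ (α + β) (f.1 * g.1) (le_map_mul f.2 g.2)) <| by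
    rintro ⟨f, hf⟩ ⟨g, hg⟩ ⟨f', hf'⟩ ⟨g', hg'⟩ h1 h2
    rw [QuotientAddGroup.leftRel_apply, AddSubgroup.mem_addSubgroupOf] at h1 h2
    change (α : WithTop Λ) < μ (-f + f') at h1
    change (β : WithTop Λ) < μ (-g + g') at h2
    change (α : WithTop Λ) ≤ μ f at hf
    change (β : WithTop Λ) ≤ μ g' at hg'
    refine (grMk_eq_iff _ _).2 ?_
    have e : -(f * g) + f' * g' = (-f + f') * g' + (-g + g') * f := by ring
    change _ < μ (-(f * g) + f' * g')
    rw [e]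
    refine μ.map_lt_add (lt_map_mul_left h1 hg') ?_
    rw [add_comm α β]
    exact lt_map_mul_left h2 hf

theorem grMul_mk {α β : Λ} {f g : A} (hf : (α : WithTop Λ) ≤ μ f) (hg : (β : WithTop Λ) ≤ μ g) :
    grMul (grMk μ α f hf) (grMk μ β g hg) = grMk μ (α + β) (f * g) (le_map_mul hf hg) := rfl

theorem grMk_add {α : Λ} {f g : A} (hf : (α : WithTop Λ) ≤ μ f) (hg : (α : WithTop Λ) ≤ μ g) :
    grMk μ α f hf + grMk μ α g hg = grMk μ α (f + g) (μ.map_le_add hf hg) := rfl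

theorem grMk_zero {α : Λ} : (0 : GrComponent μ α) = grMk μ α 0 (by simp) := rfl

theorem grMk_congr {α : Λ} {f g : A} (hf : (α : WithTop Λ) ≤ μ f) (hg : (α : WithTop Λ) ≤ μ g)
    (h : f = g) : grMk μ α f hf = grMk μ α g hg := by
  subst h; rfl

theorem grMk_sigma {α β : Λ} {f g : A} (hf : (α : WithTop Λ) ≤ μ f) (hg : (β : WithTop Λ) ≤ μ g)
    (hab : α = β) (h : f = g) :
    (GradedMonoid.mk α (grMk μ α f hf) : GradedMonoid (GrComponent μ)) =
      GradedMonoid.mk β (grMk μ β g hg) := by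
  subst hab; subst h; rfl

theorem zero_le_natCast (n : ℕ) : ((0 : Λ) : WithTop Λ) ≤ μ (n : A) := by
  induction n with
  | zero => simp
  | succ k ih =>
    rw [Nat.cast_succ]
    exact μ.map_le_add ih (by simp)

theorem zero_le_intCast (n : ℤ) : ((0 : Λ) : WithTop Λ) ≤ μ (n : A) := by
  obtain ⟨k, rfl | rfl⟩ := n.eq_nat_or_neg
  · simpa using zero_le_natCast (μ := μ) k
  · simpa using zero_le_natCast (μ := μ) k

instance instGMul (μ : AddValuation A (WithTop Λ)) : GradedMonoid.GMul (GrComponent μ) where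
  mul := grMul

instance instGOne (μ : AddValuation A (WithTop Λ)) : GradedMonoid.GOne (GrComponent μ) where
  one := grMk μ 0 1 (by simp)

instance instGCommRing (μ : AddValuation A (WithTop Λ)) :
    DirectSum.GCommRing (GrComponent μ) where
  mul_zero := by
    intro i j a
    obtain ⟨f, hf, rfl⟩ := grMk_surj a
    exact grMk_congr _ _ (mul_zero f)
  zero_mul := by
    intro i j a
    obtain ⟨f, hf, rfl⟩ := grMk_surj a
    exact grMk_congr _ _ (zero_mul f)
  mul_add := by
    intro i j a b c
    obtain ⟨f, hf, rfl⟩ := grMk_surj a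
    obtain ⟨g, hg, rfl⟩ := grMk_surj b
    obtain ⟨h, hh, rfl⟩ := grMk_surj c
    exact grMk_congr _ _ (mul_add f g h)
  add_mul := by
    intro i j a b c
    obtain ⟨f, hf, rfl⟩ := grMk_surj a
    obtain ⟨g, hg, rfl⟩ := grMk_surj b
    obtain ⟨h, hh, rfl⟩ := grMk_surj c
    exact grMk_congr _ _ (add_mul f g h)
  one_mul := by
    rintro ⟨i, a⟩
    obtain ⟨f, hf, rfl⟩ := grMk_surj a
    exact grMk_sigma _ _ (zero_add i) (one_mul f)
  mul_one := by
    rintro ⟨i, a⟩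
    obtain ⟨f, hf, rfl⟩ := grMk_surj a
    exact grMk_sigma _ _ (add_zero i) (mul_one f)
  mul_assoc := by
    rintro ⟨i, a⟩ ⟨j, b⟩ ⟨k, c⟩
    obtain ⟨f, hf, rfl⟩ := grMk_surj a
    obtain ⟨g, hg, rfl⟩ := grMk_surj b
    obtain ⟨h, hh, rfl⟩ := grMk_surj c
    exact grMk_sigma _ _ (add_assoc i j k) (mul_assoc f g h)
  mul_comm := by
    rintro ⟨i, a⟩ ⟨j, b⟩
    obtain ⟨f, hf, rfl⟩ := grMk_surj a
    obtain ⟨g, hg, rfl⟩ := grMk_surj b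
    exact grMk_sigma _ _ (add_comm i j) (mul_comm f g)
  natCast := fun n => grMk μ 0 (n : A) (zero_le_natCast n)
  natCast_zero := grMk_congr _ _ Nat.cast_zero
  natCast_succ := fun n => grMk_congr _ _ (Nat.cast_succ n)
  intCast := fun n => grMk μ 0 (n : A) (zero_le_intCast n)
  intCast_ofNat := fun n => grMk_congr _ _ (Int.cast_natCast n)
  intCast_negSucc_ofNat := fun n => grMk_congr _ _ (Int.cast_negSucc n)

/-- The graded algebra `𝒢_μ = ⨁_α 𝒫_α / 𝒫_α⁺`. Indexing by all of `Λ` instead of the value group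
of `μ` only adds zero summands. -/
abbrev GradedAlg (μ : AddValuation A (WithTop Λ)) : Type _ :=
  ⨁ α : Λ, GrComponent μ α

open Classical in
/-- The initial form `in_μ f`, the image of `f` in `𝒫_{μ(f)} / 𝒫_{μ(f)}⁺ ⊆ 𝒢_μ`. It is meant for
`f` outside the support of `μ`; on the support it is given the value `0`. -/
def inForm (μ : AddValuation A (WithTop Λ)) (f : A) : GradedAlg μ :=
  if h : μ f = ⊤ then 0
  else DirectSum.of (GrComponent μ) ((μ f).untop h) (grMk μ ((μ f).untop h) f (by simp))

/-- `f ∼_μ g`, for `f`, `g` outside the support of `μ`. -/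
def MuEquiv (μ : AddValuation A (WithTop Λ)) (f g : A) : Prop :=
  μ f ≠ ⊤ ∧ μ g ≠ ⊤ ∧ inForm μ f = inForm μ g

/-- `μ < η` means that `μ f ≤ η f` for all `f`, and `μ ≠ η`. -/
def ValLT (μ η : AddValuation A (WithTop Λ)) : Prop :=
  (∀ f, μ f ≤ η f) ∧ μ ≠ η

end GradedAlgebra

section Polynomials

variable {K : Type*} [Field K]
variable {Λ : Type*} [AddCommGroup Λ] [LinearOrder Λ] [IsOrderedAddMonoid Λ]

/-- `(K, v)` is henselian: the valuation ring of `v` has a unique prolongation to a valuation ring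
of an algebraic closure of `K`, that is, `v` extends uniquely (up to equivalence). -/
def IsHenselianValued (v : AddValuation K (WithTop Λ)) : Prop :=
  ∃! B : ValuationSubring (AlgebraicClosure K),
    ∀ a : K, algebraMap K (AlgebraicClosure K) a ∈ B ↔ 0 ≤ v a

/-- The valuation `f ↦ vbar (f(θ))` on `K[x]`. When `θ` is a root of `F`, this is `v_F`. -/
def rootVal (vbar : AddValuation (AlgebraicClosure K) (WithTop Λ)) (θ : AlgebraicClosure K) :
    AddValuation K[X] (WithTop Λ) :=
  vbar.comap (aeval θ : K[X] →ₐ[K] AlgebraicClosure K).toRingHom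

/-- Mac Lane--Vaquié key polynomials: monic `φ`, outside the support and with `in_μ φ` not a unit,
which is `μ`-irreducible and `μ`-minimal. -/
structure IsKeyPoly (μ : AddValuation K[X] (WithTop Λ)) (φ : K[X]) : Prop where
  monic : φ.Monic
  ne_top : μ φ ≠ ⊤
  not_isUnit : ¬ IsUnit (inForm μ φ)
  irred : ∀ f g : K[X], inForm μ φ ∣ inForm μ (f * g) →
    inForm μ φ ∣ inForm μ f ∨ inForm μ φ ∣ inForm μ g
  minimal : ∀ f : K[X], f ≠ 0 → inForm μ φ ∣ inForm μ f → φ.natDegree ≤ f.natDegree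

/-- The class `[φ]_μ` of key polynomials that are `μ`-equivalent to `φ`. -/
def keyClass (μ : AddValuation K[X] (WithTop Λ)) (φ : K[X]) : Set K[X] :=
  {ψ | IsKeyPoly μ ψ ∧ MuEquiv μ φ ψ}

/-- The tangent direction `t(μ, η)`: the monic polynomials of minimal degree among the monic `φ`
with `μ φ < η φ`. -/
def tangentDir (μ η : AddValuation K[X] (WithTop Λ)) : Set K[X] :=
  {φ | φ.Monic ∧ μ φ < η φ ∧
    ∀ ψ : K[X], ψ.Monic → μ ψ < η ψ → φ.natDegree ≤ ψ.natDegree}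

/-- `a` is the family of coefficients of the `φ`-expansion `f = ∑ a_n φ^n`, `deg a_n < deg φ`. -/
def IsExpansion (φ f : K[X]) (a : ℕ →₀ K[X]) : Prop :=
  (∀ n, (a n).degree < φ.degree) ∧ f = a.sum fun n c => c * φ ^ n

/-- The points `(n, μ(a_n))` with `a_n ≠ 0`, for the `φ`-expansion `g = ∑ a_n φ^n`. -/
def newtonPoints (μ : AddValuation K[X] (WithTop Λ)) (φ g : K[X]) : Set (ℚ × Λ) :=
  {p | ∃ a : ℕ →₀ K[X], IsExpansion φ g a ∧
    ∃ n : ℕ, a n ≠ 0 ∧ p.1 = (n : ℚ) ∧ μ (a n) = (p.2 : WithTop Λ)}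

variable [Module ℚ Λ]

/-- The lower boundary of the convex hull of a set of points of `ℚ × Λ`. -/
def lowerHull (S : Set (ℚ × Λ)) : Set (ℚ × Λ) :=
  {p | p ∈ convexHull ℚ S ∧ ∀ β : Λ, (p.1, β) ∈ convexHull ℚ S → p.2 ≤ β}

/-- The Newton polygon `N_{μ,φ}(g)`. -/
def newtonPolygon (μ : AddValuation K[X] (WithTop Λ)) (φ g : K[X]) : Set (ℚ × Λ) :=
  lowerHull (newtonPoints μ φ g)

/-- The `γ`-component `S_γ(N)`: the points `(n, α)` of `N` at which `α + nγ` is minimal. -/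
def component (N : Set (ℚ × Λ)) (γ : Λ) : Set (ℚ × Λ) :=
  {p | p ∈ N ∧ ∀ q ∈ N, p.2 + p.1 • γ ≤ q.2 + q.1 • γ}

/-- `N` is one-sided of slope `-γ`: it equals its `γ`-component, whose left endpoint has abscissa
zero and whose right endpoint has positive abscissa. -/
def IsOneSided (N : Set (ℚ × Λ)) (γ : Λ) : Prop :=
  N = component N γ ∧ IsLeast (Prod.fst '' component N γ) 0 ∧
    ∃ m : ℚ, 0 < m ∧ IsGreatest (Prod.fst '' component N γ) m

/-- `l` is the length of `N`, the abscissa of its right endpoint. -/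
def HasLength (N : Set (ℚ × Λ)) (l : ℚ) : Prop :=
  IsGreatest (Prod.fst '' N) l

end Polynomials

end ValPoly

end

/-! For `f` in `K[x]` let `g = ∑ b_j x^j`, of degree `d`, be the minimal polynomial of `f(θ)` over
`K`. Then `F` divides `g(f)`, so `in_μ Q ∣ in_μ F` gives `in_μ Q ∣ in_μ g(f)`. As `v` is henselian,
all conjugates of `f(θ)` have the same value. If this value is some finite `γ`, then `v(b_j) ≥ (d -
j)γ`, with equality at `j = 0` and `j = d` (`map_coeff_minpoly`).

If `γ < μ(f)`, then `g(f)` has the initial form of the constant `b_0`, a unit, which `in_μ Q` cannot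
divide; hence `μ ≤ v_F` (`rootVal_le`). If `μ(f) < γ`, it has the initial form of `f^d`, so `in_μ Q
∣ in_μ f` (`dvd_of_lt_rootVal`). For `f = Q`, equality `μ(Q) = γ` would let a multiple of `Q` cancel
the leading part of `b_0`, against minimality (`map_lt_rootVal_self`). Thus `μ(f) < v_F(f)` exactly
when `in_μ Q ∣ in_μ f`, and this determines the tangent direction. Conversely, if `in_μ Q ∤ in_μ F`,
the remainder of `F` modulo `Q` dominates and keeps its value under `v_F`, so `v_F(F)` would be
finite (`dvd_of_tangentDir_eq`).

For the Newton polygon, take `f = Q` and give `Q` the weight `γ = v_F(Q) > μ(Q)`. The last index of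
minimal weight is additive under products (`LeadsAt.mul`). In `g(Q) = F * H` it is `d`, the largest
that the degree allows, so it is the largest possible for `F` as well. Comparing constant digits
gives the left endpoint (`exists_digit_bounds`). Since `μ(Q) < γ`, all other terms of `F` then have
larger `μ`-value than `Q^l`. -/

noncomputable section

namespace ValPoly

/-! ### Initial forms and divisibility in the graded algebra -/

section InitialForms

variable {A : Type*} [CommRing A]
variable {Λ : Type*} [AddCommGroup Λ] [LinearOrder Λ] [IsOrderedAddMonoid Λ]
variable {μ : AddValuation A (WithTop Λ)}

theorem inForm_eq_of {f : A} {α : Λ} (h : μ f = α) :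
    inForm μ f = DirectSum.of (GrComponent μ) α (grMk μ α f h.ge) := by
  have hne : μ f ≠ ⊤ := by simp [h]
  obtain rfl : (μ f).untop hne = α := by simp [h]
  rw [inForm, dif_neg hne]

theorem inForm_of_eq_top {f : A} (h : μ f = ⊤) : inForm μ f = 0 := dif_pos h

theorem map_neg_add_eq (f g : A) : μ (-f + g) = μ (f - g) := by
  rw [← μ.map_sub_swap, neg_add_eq_sub]

theorem inForm_mul (f g : A) : inForm μ (f * g) = inForm μ f * inForm μ g := by
  by_cases hf : μ f = ⊤
  · rw [inForm_of_eq_top hf, inForm_of_eq_top (by rw [μ.map_mul, hf, top_add]), zero_mul]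
  by_cases hg : μ g = ⊤
  · rw [inForm_of_eq_top hg, inForm_of_eq_top (by rw [μ.map_mul, hg, add_top]), mul_zero]
  obtain ⟨α, hα⟩ := WithTop.ne_top_iff_exists.1 hf
  obtain ⟨β, hβ⟩ := WithTop.ne_top_iff_exists.1 hg
  rw [inForm_eq_of hα.symm, inForm_eq_of hβ.symm, DirectSum.of_mul_of,
    inForm_eq_of (α := α + β) (by rw [μ.map_mul, ← hα, ← hβ, WithTop.coe_add])]
  rfl

theorem inForm_one : inForm μ (1 : A) = 1 := by
  rw [inForm_eq_of (α := 0) (by simp)]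
  rfl

/-- Degrees cancel in the group `Λ`, so only the component of `z` in degree `β` contributes. This
reduces divisibility by a homogeneous element to one component. -/
theorem of_mul_apply_add {α : Λ} (a : GrComponent μ α) (z : GradedAlg μ) (β : Λ) :
    (DirectSum.of (GrComponent μ) α a * z) (α + β) = grMul a (z β) := by
  induction z using DirectSum.induction_on with
  | zero =>
    rw [mul_zero]
    exact (DirectSum.GCommRing.toGRing.mul_zero a).symm
  | of i x =>
    rw [DirectSum.of_mul_of]
    by_cases h : i = β
    · subst h
      rw [DirectSum.of_eq_same, DirectSum.of_eq_same]
      rfl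
    · rw [DirectSum.of_eq_of_ne _ _ _ (fun e => h (add_left_cancel e).symm),
        DirectSum.of_eq_of_ne _ _ _ (fun e => h e.symm)]
      exact (DirectSum.GCommRing.toGRing.mul_zero a).symm
  | add x y hx hy =>
    rw [mul_add, DirectSum.add_apply, DirectSum.add_apply, hx, hy]
    exact (DirectSum.GCommRing.toGRing.mul_add a _ _).symm

theorem inForm_eq_of_lt {f g : A} (h : μ f < μ (f - g)) : inForm μ f = inForm μ g := by
  have hf : μ f ≠ ⊤ := h.ne_top
  obtain ⟨α, hα⟩ := WithTop.ne_top_iff_exists.1 hf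
  have hg : μ g = α := by
    rw [hα]
    have := μ.map_eq_of_lt_sub (x := f) (y := g)
    have e : μ (g - f) = μ (f - g) := μ.map_sub_swap g f
    exact this (by rwa [e])
  rw [inForm_eq_of hα.symm, inForm_eq_of hg]
  congr 1
  rwa [grMk_eq_iff, hα, map_neg_add_eq]

theorem muEquiv_iff {f g : A} : MuEquiv μ f g ↔ μ f < μ (f - g) := by
  constructor
  · rintro ⟨hf, hg, h⟩
    obtain ⟨α, hα⟩ := WithTop.ne_top_iff_exists.1 hf
    obtain ⟨β, hβ⟩ := WithTop.ne_top_iff_exists.1 hg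
    rw [inForm_eq_of hα.symm, inForm_eq_of hβ.symm] at h
    have h1 := congrArg (fun z : GradedAlg μ => z α) h
    simp only [DirectSum.of_eq_same] at h1
    by_cases hab : α = β
    · subst hab
      rwa [DirectSum.of_eq_same, grMk_eq_iff, hα, map_neg_add_eq] at h1
    · rw [DirectSum.of_eq_of_ne _ _ _ hab, grMk_zero, grMk_eq_iff, add_zero, μ.map_neg, hα] at h1
      exact absurd h1 (lt_irrefl _)
  · intro h
    refine ⟨h.ne_top, ?_, inForm_eq_of_lt h⟩
    have e : μ (g - f) = μ (f - g) := μ.map_sub_swap g f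
    rw [μ.map_eq_of_lt_sub (x := f) (y := g) (by rwa [e])]
    exact h.ne_top

/-- The cofactor in the graded algebra may be replaced by its component of degree `μ g - μ f`, which
lifts to the ring. Divisibility thus becomes a statement about values alone. -/
theorem inForm_dvd_iff {f g : A} (hf : μ f ≠ ⊤) (hg : μ g ≠ ⊤) :
    inForm μ f ∣ inForm μ g ↔ ∃ h, μ g < μ (g - f * h) := by
  constructor
  · rintro ⟨z, hz⟩
    obtain ⟨α, hα⟩ := WithTop.ne_top_iff_exists.1 hf
    obtain ⟨β, hβ⟩ := WithTop.ne_top_iff_exists.1 hg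
    obtain ⟨δ, rfl⟩ : ∃ δ, β = α + δ := ⟨β - α, by abel⟩
    rw [inForm_eq_of hα.symm, inForm_eq_of hβ.symm] at hz
    have h1 := congrArg (fun z : GradedAlg μ => z (α + δ)) hz
    simp only [DirectSum.of_eq_same, of_mul_apply_add] at h1
    obtain ⟨h, hh, e⟩ := grMk_surj (z δ)
    rw [e, grMul_mk, grMk_eq_iff, hβ, map_neg_add_eq] at h1
    exact ⟨h, h1⟩
  · rintro ⟨h, hh⟩
    rw [inForm_eq_of_lt hh, inForm_mul]
    exact dvd_mul_right _ _

theorem isUnit_inForm_of_mul_eq_one {f g : A} (h : f * g = 1) : IsUnit (inForm μ f) :=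
  IsUnit.of_mul_eq_one _ (by rw [← inForm_mul, h, inForm_one])

end InitialForms

/-! ### Conjugates over a henselian field -/

section Henselian

variable {K : Type*} [Field K]
variable {Λ : Type*} [AddCommGroup Λ] [LinearOrder Λ] [IsOrderedAddMonoid Λ]

theorem map_inv_add_map {L : Type*} [Field L] (w : AddValuation L (WithTop Λ)) {x : L}
    (hx : x ≠ 0) : w x⁻¹ + w x = 0 := by
  rw [← w.map_mul, inv_mul_cancel₀ hx, w.map_one]

/-- The elements of nonnegative value. -/
def valSubring {L : Type*} [Field L] (w : AddValuation L (WithTop Λ)) : ValuationSubring L where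
  carrier := {x | 0 ≤ w x}
  zero_mem' := by simp
  one_mem' := by simp
  add_mem' := fun ha hb => w.map_le_add ha hb
  mul_mem' := fun {a b} ha hb => by
    change 0 ≤ w (a * b)
    rw [w.map_mul]
    exact add_nonneg ha hb
  neg_mem' := fun {x} hx => by
    change 0 ≤ w (-x)
    rwa [w.map_neg]
  mem_or_inv_mem' := fun x => by
    by_cases hx : x = 0
    · left; simp [hx]
    · change 0 ≤ w x ∨ 0 ≤ w x⁻¹
      by_contra! h
      have := map_inv_add_map w hx
      have h2 := WithTop.add_lt_add_of_lt_of_le h.1.ne_top h.2 h.1.le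
      rw [this, add_zero] at h2
      exact lt_irrefl _ h2

variable {v : AddValuation K (WithTop Λ)} {vbar : AddValuation (AlgebraicClosure K) (WithTop Λ)}

/-- Uniqueness of the prolonged valuation ring makes `vbar` and `vbar ∘ σ` share their ring, hence
the order of their values. Equality of the values themselves needs a further argument. -/
theorem map_lt_map_of_algEquiv (hv : IsHenselianValued v)
    (hvbar : ∀ a : K, vbar (algebraMap K (AlgebraicClosure K) a) = v a)
    (σ : AlgebraicClosure K ≃ₐ[K] AlgebraicClosure K) {x y : AlgebraicClosure K}
    (h : vbar x < vbar y) : vbar (σ x) < vbar (σ y) := by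
  have hx : x ≠ 0 := by rintro rfl; simp at h
  have hσx : σ x ≠ 0 := by simpa using hx
  have key : ∀ z, 0 ≤ vbar (σ z) → 0 ≤ vbar z := by
    intro z hz
    have e : valSubring (vbar.comap (σ : AlgebraicClosure K →+* AlgebraicClosure K)) =
        valSubring vbar := by
      refine hv.unique (fun a => ?_) (fun a => ?_)
      · change 0 ≤ vbar (σ _) ↔ _
        rw [σ.commutes, hvbar]
      · change 0 ≤ vbar _ ↔ _
        rw [hvbar]
    have : z ∈ valSubring (vbar.comap (σ : AlgebraicClosure K →+* AlgebraicClosure K)) := hz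
    rw [e] at this
    exact this
  by_contra! hle
  have h1 : 0 ≤ vbar (σ (x * y⁻¹)) := by
    by_cases hy : y = 0
    · simp [hy]
    have hσy : σ y ≠ 0 := by simpa using hy
    rw [map_mul, map_inv₀, vbar.map_mul, ← map_inv_add_map vbar hσy, add_comm]
    gcongr
  have h2 := key _ h1
  have hy : y ≠ 0 := by
    rintro rfl
    have : vbar (σ x) = ⊤ := by simpa using hle
    exact hσx (vbar.top_iff.1 this)
  rw [vbar.map_mul, ← map_inv_add_map vbar hy, add_comm (vbar x)] at h2
  have hyi : vbar y⁻¹ ≠ ⊤ := fun e => inv_ne_zero hy (vbar.top_iff.1 e)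
  exact absurd h ((WithTop.add_le_add_iff_left hyi).1 h2).not_gt

/-- Since `σ` preserves the order of values, a strict increase would repeat along the orbit of `x`.
That orbit would be infinite, yet it consists of roots of one minimal polynomial. -/
theorem not_map_lt_map_algEquiv (hv : IsHenselianValued v)
    (hvbar : ∀ a : K, vbar (algebraMap K (AlgebraicClosure K) a) = v a)
    (σ : AlgebraicClosure K ≃ₐ[K] AlgebraicClosure K) (x : AlgebraicClosure K) :
    ¬ vbar x < vbar (σ x) := by
  intro h
  have step : ∀ n : ℕ, vbar (σ^[n] x) < vbar (σ^[n + 1] x) := by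
    intro n
    induction n with
    | zero => simpa using h
    | succ n ih =>
      rw [Function.iterate_succ_apply' σ (n + 1), Function.iterate_succ_apply' σ n]
      rw [Function.iterate_succ_apply' σ n] at ih
      exact map_lt_map_of_algEquiv hv hvbar σ ih
  have hinj : Function.Injective fun n : ℕ => σ^[n] x := by
    have : StrictMono fun n : ℕ => vbar (σ^[n] x) := strictMono_nat_of_lt_succ step
    exact fun a b hab => this.injective (congrArg vbar hab)
  have hne : minpoly K x ≠ 0 := minpoly.ne_zero (Algebra.IsIntegral.isIntegral x)
  refine Set.infinite_range_of_injective hinj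
    (((minpoly K x).rootSet_finite (AlgebraicClosure K)).subset ?_)
  rintro _ ⟨n, rfl⟩
  rw [mem_rootSet_of_ne hne]
  induction n with
  | zero => simp
  | succ n ih =>
    simp only [Function.iterate_succ_apply']
    change aeval (σ.toAlgHom (σ^[n] x)) (minpoly K x) = 0
    rw [aeval_algHom_apply]
    exact (congrArg σ ih).trans (map_zero σ)

theorem map_algEquiv_eq (hv : IsHenselianValued v)
    (hvbar : ∀ a : K, vbar (algebraMap K (AlgebraicClosure K) a) = v a)
    (σ : AlgebraicClosure K ≃ₐ[K] AlgebraicClosure K) (x : AlgebraicClosure K) :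
    vbar (σ x) = vbar x := by
  refine le_antisymm (not_lt.1 (not_map_lt_map_algEquiv hv hvbar σ x)) (not_lt.1 fun h => ?_)
  refine not_map_lt_map_algEquiv hv hvbar σ.symm (σ x) ?_
  simpa using h

theorem le_map_coeff_prod_X_sub_C {L : Type*} [Field L] (w : AddValuation L (WithTop Λ)) {γ : Λ}
    (s : Multiset L) (hs : ∀ r ∈ s, w r = γ) (j : ℕ) :
    ((s.card • γ : Λ) : WithTop Λ) ≤ w ((s.map fun r => X - C r).prod.coeff j) + (j • γ : Λ) := by
  induction s using Multiset.induction_on generalizing j with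
  | empty =>
    rcases j with _ | j
    · simp
    · simp [coeff_one]
  | cons a s ih =>
    have ih' := ih fun r hr => hs r (Multiset.mem_cons_of_mem hr)
    have ha : w a = γ := hs a (Multiset.mem_cons_self a s)
    rw [Multiset.map_cons, Multiset.prod_cons, Multiset.card_cons, sub_mul, coeff_sub, coeff_C_mul]
    set p := (s.map fun r => X - C r).prod
    have h2 : ((((s.card + 1) • γ : Λ)) : WithTop Λ) ≤ w (a * p.coeff j) + (j • γ : Λ) := by
      rw [w.map_mul, ha, succ_nsmul', WithTop.coe_add, add_assoc]
      gcongr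
      exact ih' j
    have h1 : ((((s.card + 1) • γ : Λ)) : WithTop Λ) ≤ w ((X * p).coeff j) + (j • γ : Λ) := by
      rcases j with _ | j
      · simp
      · rw [coeff_X_mul, succ_nsmul, succ_nsmul, WithTop.coe_add, WithTop.coe_add, ← add_assoc]
        gcongr
        exact ih' j
    rcases min_le_iff.1 (w.map_sub ((X * p).coeff j) (a * p.coeff j)) with h | h
    · exact h1.trans (by gcongr)
    · exact h2.trans (by gcongr)

theorem map_coeff_zero_prod_X_sub_C {L : Type*} [Field L] (w : AddValuation L (WithTop Λ)) {γ : Λ}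
    (s : Multiset L) (hs : ∀ r ∈ s, w r = γ) :
    w ((s.map fun r => X - C r).prod.coeff 0) = (s.card • γ : Λ) := by
  induction s using Multiset.induction_on with
  | empty => simp
  | cons a s ih =>
    rw [Multiset.map_cons, Multiset.prod_cons, Multiset.card_cons, mul_coeff_zero, w.map_mul,
      ih fun r hr => hs r (Multiset.mem_cons_of_mem hr), succ_nsmul', WithTop.coe_add]
    simp [hs a (Multiset.mem_cons_self a s)]

/-- Over a henselian field the Newton polygon of a minimal polynomial is one-sided. -/
theorem map_coeff_minpoly (hv : IsHenselianValued v)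
    (hvbar : ∀ a : K, vbar (algebraMap K (AlgebraicClosure K) a) = v a)
    (x : AlgebraicClosure K) {γ : Λ} (hx : vbar x = γ) :
    v ((minpoly K x).coeff 0) = ((minpoly K x).natDegree • γ : Λ) ∧
    ∀ j, (((minpoly K x).natDegree • γ : Λ) : WithTop Λ) ≤
      v ((minpoly K x).coeff j) + (j • γ : Λ) := by
  have hint : IsIntegral K x := Algebra.IsIntegral.isIntegral x
  set g := (minpoly K x).map (algebraMap K (AlgebraicClosure K)) with hg
  have hs : g.Splits := IsAlgClosed.splits g
  have hm : g.Monic := (minpoly.monic hint).map _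
  have hprod : g = (g.roots.map fun r => X - C r).prod := by
    simpa using hs.eq_prod_roots_of_monic hm
  have hcard : g.roots.card = (minpoly K x).natDegree := by
    rw [← hs.natDegree_eq_card_roots, hg, natDegree_map]
  have hroots : ∀ r ∈ g.roots, vbar r = γ := by
    intro r hr
    have hr' : aeval r (minpoly K x) = 0 := by
      rw [mem_roots hm.ne_zero, IsRoot, hg, eval_map_algebraMap] at hr
      exact hr
    obtain ⟨σ, rfl⟩ := minpoly.exists_algEquiv_of_root (K := K)
      (Algebra.IsAlgebraic.isAlgebraic x) hr'
    rw [← hx, map_algEquiv_eq hv hvbar]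
  have hcoeff : ∀ j, v ((minpoly K x).coeff j) = vbar (g.coeff j) := fun j => by
    rw [hg, coeff_map, hvbar]
  rw [← hcard]
  constructor
  · rw [hcoeff, hprod]
    nth_rewrite 2 [← hprod]
    exact map_coeff_zero_prod_X_sub_C vbar _ hroots
  · intro j
    rw [hcoeff]
    nth_rewrite 2 [hprod]
    exact le_map_coeff_prod_X_sub_C vbar _ hroots j

end Henselian

/-! ### Consequences of minimality and irreducibility of a key polynomial -/

section KeyPolynomials

variable {K : Type*} [Field K]
variable {Λ : Type*} [AddCommGroup Λ] [LinearOrder Λ] [IsOrderedAddMonoid Λ]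
variable {μ : AddValuation K[X] (WithTop Λ)} {Q : K[X]}

theorem isUnit_inForm_C {b : K} (hb : b ≠ 0) : IsUnit (inForm μ (C b)) :=
  isUnit_inForm_of_mul_eq_one (g := C b⁻¹) (by rw [← C_mul, mul_inv_cancel₀ hb, C_1])

namespace IsKeyPoly

/-- The support is a prime ideal of a principal ideal domain. If nonzero it is maximal, and an
inverse of `Q` modulo it would make `in_μ Q` a unit. -/
theorem eq_zero_of_map_eq_top (hQ : IsKeyPoly μ Q) {f : K[X]} (hf : μ f = ⊤) : f = 0 := by
  by_contra h0
  have hmax : μ.supp.IsMaximal := by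
    have hprime : μ.supp.IsPrime := by
      refine Ideal.isPrime_iff.2 ⟨fun h => hQ.ne_top ?_, fun {x y} h => ?_⟩
      · exact (μ.mem_supp_iff Q).1 (h ▸ Submodule.mem_top)
      · rw [μ.mem_supp_iff, μ.map_mul] at h
        exact WithTop.add_eq_top.1 h
    refine IsPrime.to_maximal_ideal fun h => h0 ?_
    rw [← Ideal.mem_bot, ← h]
    exact hf
  obtain ⟨y, i, hi, e⟩ := hmax.exists_inv (x := Q) hQ.ne_top
  refine hQ.not_isUnit (IsUnit.of_mul_eq_one (inForm μ y) ?_)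
  have hi' : μ i = ⊤ := hi
  rw [← inForm_mul, ← inForm_one (μ := μ)]
  refine (inForm_eq_of_lt ?_).symm
  rw [show (1 : K[X]) - Q * y = i by rw [← e]; ring, hi', μ.map_one]
  exact WithTop.coe_lt_top 0

theorem map_ne_top (hQ : IsKeyPoly μ Q) {f : K[X]} (hf : f ≠ 0) : μ f ≠ ⊤ :=
  fun h => hf (hQ.eq_zero_of_map_eq_top h)

theorem exists_map_eq (hQ : IsKeyPoly μ Q) {f : K[X]} (hf : f ≠ 0) : ∃ α : Λ, μ f = α := by
  obtain ⟨α, h⟩ := WithTop.ne_top_iff_exists.1 (hQ.map_ne_top hf)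
  exact ⟨α, h.symm⟩

theorem dvd_iff (hQ : IsKeyPoly μ Q) {f : K[X]} (hf : f ≠ 0) :
    inForm μ Q ∣ inForm μ f ↔ ∃ h, μ f < μ (f - Q * h) :=
  inForm_dvd_iff hQ.ne_top (hQ.map_ne_top hf)

theorem natDegree_pos (hQ : IsKeyPoly μ Q) : 0 < Q.natDegree := by
  rw [Nat.pos_iff_ne_zero]
  intro h
  apply hQ.not_isUnit
  rw [hQ.monic.natDegree_eq_zero.1 h, inForm_one]
  exact isUnit_one

theorem not_dvd (hQ : IsKeyPoly μ Q) {f : K[X]} (hf : f ≠ 0) (hd : f.degree < Q.degree) :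
    ¬ inForm μ Q ∣ inForm μ f := fun h =>
  (natDegree_lt_natDegree hf hd).not_ge (hQ.minimal f hf h)

/-- A larger value would mean that a multiple of `Q` cancels the initial form of `r`, whose degree
is too small for that. -/
theorem map_add_mul_le (hQ : IsKeyPoly μ Q) {r : K[X]} (hr : r.degree < Q.degree) (h : K[X]) :
    μ (r + Q * h) ≤ μ r := by
  by_contra! hlt
  have hr0 : r ≠ 0 := by rintro rfl; simp at hlt
  exact hQ.not_dvd hr0 hr ((hQ.dvd_iff hr0).2 ⟨-h, by rwa [mul_neg, sub_neg_eq_add]⟩)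

/-- By irreducibility `in_μ Q` does not divide the initial form of the product of two nonzero
reduced polynomials, so reduction modulo `Q` cannot raise the value. -/
theorem map_modByMonic_mul (hQ : IsKeyPoly μ Q) {a b : K[X]} (ha : a.degree < Q.degree)
    (hb : b.degree < Q.degree) : μ ((a * b) %ₘ Q) = μ (a * b) := by
  by_cases ha0 : a = 0
  · simp [ha0]
  by_cases hb0 : b = 0
  · simp [hb0]
  refine le_antisymm (not_lt.1 fun hlt => ?_) ?_
  · have h : inForm μ Q ∣ inForm μ (a * b) := by
      refine (hQ.dvd_iff (mul_ne_zero ha0 hb0)).2 ⟨(a * b) /ₘ Q, ?_⟩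
      rwa [← modByMonic_eq_sub_mul_div]
    rcases hQ.irred a b h with h | h
    · exact hQ.not_dvd ha0 ha h
    · exact hQ.not_dvd hb0 hb h
  · conv_lhs => rw [← modByMonic_add_div (a * b) Q]
    exact hQ.map_add_mul_le (degree_modByMonic_lt _ hQ.monic) _

theorem map_le_map_mul_divByMonic (hQ : IsKeyPoly μ Q) (f : K[X]) :
    μ f ≤ μ (Q * (f /ₘ Q)) := by
  have h1 : μ f ≤ μ (f %ₘ Q) := by
    conv_lhs => rw [← modByMonic_add_div f Q]
    exact hQ.map_add_mul_le (degree_modByMonic_lt _ hQ.monic) _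
  rw [show Q * (f /ₘ Q) = f - f %ₘ Q by rw [modByMonic_eq_sub_mul_div f Q]; ring]
  exact μ.map_le_sub le_rfl h1

theorem dvd_of_dvd_pow (hQ : IsKeyPoly μ Q) {f : K[X]} (n : ℕ)
    (h : inForm μ Q ∣ inForm μ (f ^ n)) : inForm μ Q ∣ inForm μ f := by
  induction n with
  | zero =>
    rw [pow_zero, inForm_one] at h
    exact absurd (isUnit_of_dvd_one h) hQ.not_isUnit
  | succ n ih =>
    rw [pow_succ] at h
    rcases hQ.irred _ _ h with h | h
    · exact ih h
    · exact h

/-- The difference `Q - f` is reduced modulo `Q`. If `f` were not equivalent to `Q`, its value would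
be at most `μ f`, while modulo `Q` it agrees with `-f`, whose value can be raised by a multiple of
`Q`. -/
theorem muEquiv_of_dvd (hQ : IsKeyPoly μ Q) {f : K[X]} (hf : f.Monic)
    (hd : f.natDegree = Q.natDegree) (h : inForm μ Q ∣ inForm μ f) : MuEquiv μ Q f := by
  rw [muEquiv_iff]
  by_contra! hle
  obtain ⟨s, hs⟩ := (hQ.dvd_iff hf.ne_zero).1 h
  have hdeg : (Q - f).degree < Q.degree := by
    refine degree_sub_lt_left ?_ hQ.monic.ne_zero (hQ.monic.leadingCoeff.trans hf.leadingCoeff.symm)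
    rw [degree_eq_natDegree hf.ne_zero, degree_eq_natDegree hQ.monic.ne_zero, hd]
  have h1 : μ (Q - f) ≤ μ f := by
    calc μ (Q - f) ≤ μ (Q - (Q - f)) := μ.map_le_sub hle le_rfl
      _ = μ f := by rw [sub_sub_cancel]
  have h2 := hQ.map_add_mul_le hdeg (s - 1)
  rw [show Q - f + Q * (s - 1) = -(f - Q * s) by ring, μ.map_neg] at h2
  exact (h1.trans_lt hs).not_ge h2

theorem of_muEquiv (hQ : IsKeyPoly μ Q) {f : K[X]} (hf : f.Monic)
    (hd : f.natDegree = Q.natDegree) (h : MuEquiv μ Q f) : IsKeyPoly μ f := by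
  obtain ⟨_, h1, e⟩ := h
  exact ⟨hf, h1, e ▸ hQ.not_isUnit, e ▸ hQ.irred, e ▸ hd ▸ hQ.minimal⟩

theorem natDegree_eq_of_muEquiv (hQ : IsKeyPoly μ Q) {f : K[X]} (hf : IsKeyPoly μ f)
    (h : MuEquiv μ Q f) : f.natDegree = Q.natDegree := by
  obtain ⟨_, _, e⟩ := h
  exact le_antisymm (hf.minimal Q hQ.monic.ne_zero (dvd_of_eq e.symm))
    (hQ.minimal f hf.monic.ne_zero (dvd_of_eq e))

/-- If the values that grow from `μ` to `η` are those of the `f` with `in_μ Q ∣ in_μ f`, then the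
tangent direction is the class of `Q`. -/
theorem tangentDir_eq (hQ : IsKeyPoly μ Q) {η : AddValuation K[X] (WithTop Λ)}
    (h : ∀ f : K[X], f ≠ 0 → (μ f < η f ↔ inForm μ Q ∣ inForm μ f)) :
    tangentDir μ η = keyClass μ Q := by
  ext f
  constructor
  · rintro ⟨hf, hlt, hmin⟩
    have hdvd := (h f hf.ne_zero).1 hlt
    have hd : f.natDegree = Q.natDegree :=
      le_antisymm (hmin Q hQ.monic ((h Q hQ.monic.ne_zero).2 dvd_rfl))
        (hQ.minimal f hf.ne_zero hdvd)
    have he := hQ.muEquiv_of_dvd hf hd hdvd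
    exact ⟨hQ.of_muEquiv hf hd he, he⟩
  · rintro ⟨hf, he⟩
    refine ⟨hf.monic, (h f hf.monic.ne_zero).2 (dvd_of_eq he.2.2), fun ψ hψ hlt => ?_⟩
    rw [hQ.natDegree_eq_of_muEquiv hf he]
    exact hQ.minimal ψ hψ.ne_zero ((h ψ hψ.ne_zero).1 hlt)

/-- If the class of `Q` is the tangent direction of `η`, then `in_μ Q` divides the initial form of each
element of the support of `η`. -/
theorem dvd_of_tangentDir_eq (hQ : IsKeyPoly μ Q) {η : AddValuation K[X] (WithTop Λ)}
    (hle : ∀ f, μ f ≤ η f) (hηC : ∀ a : K, η (C a) = μ (C a))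
    (ht : tangentDir μ η = keyClass μ Q) {F : K[X]} (hF : F ≠ 0) (hηF : η F = ⊤) :
    inForm μ Q ∣ inForm μ F := by
  have hQt : Q ∈ tangentDir μ η := by
    rw [ht]
    exact ⟨hQ, hQ.ne_top, hQ.ne_top, rfl⟩
  obtain ⟨-, hQlt, hQmin⟩ := hQt
  rw [hQ.dvd_iff hF]
  refine ⟨F /ₘ Q, ?_⟩
  rw [← modByMonic_eq_sub_mul_div]
  set r := F %ₘ Q with hr
  by_contra! hle'
  have hFtop := hQ.map_ne_top hF
  have hr0 : r ≠ 0 := by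
    intro h0
    rw [h0, μ.map_zero] at hle'
    exact hFtop (top_le_iff.1 hle')
  have hrdeg : r.degree < Q.degree := degree_modByMonic_lt _ hQ.monic
  -- After division by its leading coefficient, `r` would be a monic polynomial of degree below `deg
  -- Q` whose value grows.
  have hrη : η r = μ r := by
    refine le_antisymm (not_lt.1 fun hlt => ?_) (hle r)
    have hlc : r.leadingCoeff ≠ 0 := leadingCoeff_ne_zero.2 hr0
    have hCtop : μ (C r.leadingCoeff⁻¹) ≠ ⊤ := hQ.map_ne_top (C_ne_zero.2 (inv_ne_zero hlc))
    have hmin := hQmin (r * C r.leadingCoeff⁻¹) (monic_mul_leadingCoeff_inv hr0) (by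
      rw [μ.map_mul, η.map_mul, hηC]
      exact WithTop.add_lt_add_right hCtop hlt)
    rw [natDegree_mul_leadingCoeff_inv _ hr0] at hmin
    exact (natDegree_lt_natDegree hr0 hrdeg).not_ge hmin
  have h1 : μ F ≤ μ (Q * (F /ₘ Q)) := hQ.map_le_map_mul_divByMonic F
  -- The multiple of `Q` grows strictly in value, so the remainder alone determines `η F`.
  have h2 : η r < η (Q * (F /ₘ Q)) := by
    rw [hrη]
    refine hle'.trans_lt ?_
    by_cases hz : F /ₘ Q = 0
    · rw [hz, mul_zero, η.map_zero]
      exact hFtop.lt_top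
    · refine h1.trans_lt ?_
      rw [μ.map_mul, η.map_mul]
      calc μ Q + μ (F /ₘ Q) < η Q + μ (F /ₘ Q) :=
            WithTop.add_lt_add_right (hQ.map_ne_top hz) hQlt
        _ ≤ η Q + η (F /ₘ Q) := by gcongr; exact hle _
  have h3 : η F = η r := by
    conv_lhs => rw [← modByMonic_add_div F Q]
    exact η.map_add_eq_of_lt_left h2
  rw [hηF, hrη] at h3
  exact hQ.map_ne_top hr0 h3.symm

end IsKeyPoly

end KeyPolynomials

/-! ### Comparison of `μ` with `v_F`, and the equivalence -/

section RootValuation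

variable {K : Type*} [Field K]
variable {Λ : Type*} [AddCommGroup Λ] [LinearOrder Λ] [IsOrderedAddMonoid Λ]
variable {v : AddValuation K (WithTop Λ)} {vbar : AddValuation (AlgebraicClosure K) (WithTop Λ)}
variable {μ : AddValuation K[X] (WithTop Λ)} {Q F : K[X]} {θ : AlgebraicClosure K}

theorem rootVal_apply (f : K[X]) : rootVal vbar θ f = vbar (aeval θ f) := rfl

theorem rootVal_eq_top_iff (f : K[X]) : rootVal vbar θ f = ⊤ ↔ aeval θ f = 0 := by
  rw [rootVal_apply, vbar.top_iff]

theorem dvd_of_aeval_eq_zero (hFm : F.Monic) (hFi : Irreducible F) (hθ : aeval θ F = 0)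
    {f : K[X]} (hf : aeval θ f = 0) : F ∣ f := by
  rw [minpoly.eq_of_irreducible_of_monic hFi hθ hFm]
  exact minpoly.dvd K θ hf

theorem dvd_aeval_minpoly (hFm : F.Monic) (hFi : Irreducible F) (hθ : aeval θ F = 0)
    (f : K[X]) : F ∣ aeval f (minpoly K (aeval θ f)) := by
  refine dvd_of_aeval_eq_zero hFm hFi hθ ?_
  rw [← aeval_algHom_apply, minpoly.aeval]

theorem inForm_dvd_of_dvd {f g : K[X]} (h : f ∣ g) : inForm μ f ∣ inForm μ g := by
  obtain ⟨k, rfl⟩ := h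
  rw [inForm_mul]
  exact dvd_mul_right _ _

theorem map_C_mul_pow (hμ : ∀ a : K, μ (C a) = v a) {f : K[X]} {δ : Λ} (hf : μ f = δ) (b : K)
    (j : ℕ) : μ (C b * f ^ j) = v b + (j • δ : Λ) := by
  rw [μ.map_mul, hμ, μ.map_pow, hf, WithTop.coe_nsmul]

/-- If `f` had larger value under `μ`, the constant term of `g(f)` would dominate, with `g` the
minimal polynomial of `f(θ)`; but its initial form is a unit. -/
theorem rootVal_le (hv : IsHenselianValued v)
    (hvbar : ∀ a : K, vbar (algebraMap K (AlgebraicClosure K) a) = v a)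
    (hμ : ∀ a : K, μ (C a) = v a) (hQ : IsKeyPoly μ Q)
    (hFm : F.Monic) (hFi : Irreducible F) (hθ : aeval θ F = 0)
    (hD : inForm μ Q ∣ inForm μ F) (f : K[X]) : μ f ≤ rootVal vbar θ f := by
  by_contra! hlt
  have hf : f ≠ 0 := by rintro rfl; simp at hlt
  obtain ⟨γ, hγ⟩ := WithTop.ne_top_iff_exists.1 hlt.ne_top
  obtain ⟨δ, hδ⟩ := hQ.exists_map_eq hf
  obtain ⟨h0, hj⟩ := map_coeff_minpoly hv hvbar (aeval θ f) hγ.symm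
  rw [← hγ, hδ, WithTop.coe_lt_coe] at hlt
  have hdvd := dvd_aeval_minpoly hFm hFi hθ f
  set g := minpoly K (aeval θ f)
  have hb0 : g.coeff 0 ≠ 0 := by
    intro h
    rw [h, v.map_zero] at h0
    exact WithTop.top_ne_coe h0
  rw [aeval_eq_sum_range, Finset.sum_range_succ'] at hdvd
  have hlow : inForm μ (∑ j ∈ Finset.range g.natDegree, g.coeff (j + 1) • f ^ (j + 1) +
      g.coeff 0 • f ^ 0) = inForm μ (C (g.coeff 0)) := by
    refine (inForm_eq_of_lt ?_).symm
    rw [pow_zero, ← C_mul', mul_one, sub_add_cancel_right, μ.map_neg, hμ, h0]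
    refine μ.map_lt_sum WithTop.coe_ne_top fun j _ => ?_
    rw [← C_mul', map_C_mul_pow hμ hδ]
    by_cases hz : v (g.coeff (j + 1)) = ⊤
    · rw [hz, top_add]; exact WithTop.coe_lt_top _
    · refine (hj (j + 1)).trans_lt (WithTop.add_lt_add_left hz ?_)
      exact WithTop.coe_lt_coe.2 (nsmul_lt_nsmul_right j.succ_ne_zero hlt)
  have h1 := hD.trans (inForm_dvd_of_dvd (μ := μ) hdvd)
  rw [hlow] at h1
  exact hQ.not_isUnit (isUnit_of_dvd_unit h1 (isUnit_inForm_C hb0))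

/-- Here the top term of `g(f)` dominates, so `in_μ Q` divides a power of `in_μ f`. -/
theorem dvd_of_lt_rootVal (hv : IsHenselianValued v)
    (hvbar : ∀ a : K, vbar (algebraMap K (AlgebraicClosure K) a) = v a)
    (hμ : ∀ a : K, μ (C a) = v a) (hQ : IsKeyPoly μ Q)
    (hFm : F.Monic) (hFi : Irreducible F) (hθ : aeval θ F = 0)
    (hD : inForm μ Q ∣ inForm μ F) {f : K[X]} (hlt : μ f < rootVal vbar θ f) :
    inForm μ Q ∣ inForm μ f := by
  by_cases htop : rootVal vbar θ f = ⊤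
  · exact hD.trans (inForm_dvd_of_dvd
      (dvd_of_aeval_eq_zero hFm hFi hθ ((rootVal_eq_top_iff f).1 htop)))
  obtain ⟨γ, hγ⟩ := WithTop.ne_top_iff_exists.1 htop
  obtain ⟨δ, hδ⟩ := WithTop.ne_top_iff_exists.1 hlt.ne_top
  obtain ⟨h0, hj⟩ := map_coeff_minpoly hv hvbar (aeval θ f) hγ.symm
  rw [← hγ, ← hδ, WithTop.coe_lt_coe] at hlt
  have hdvd := dvd_aeval_minpoly hFm hFi hθ f
  have hgm : (minpoly K (aeval θ f)).Monic := minpoly.monic (Algebra.IsIntegral.isIntegral _)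
  set g := minpoly K (aeval θ f)
  rw [aeval_eq_sum_range, Finset.sum_range_succ, hgm.coeff_natDegree, one_smul] at hdvd
  refine hQ.dvd_of_dvd_pow g.natDegree ?_
  have hlow : inForm μ (f ^ g.natDegree) =
      inForm μ (∑ j ∈ Finset.range g.natDegree, g.coeff j • f ^ j + f ^ g.natDegree) := by
    refine inForm_eq_of_lt ?_
    rw [sub_add_cancel_right, μ.map_neg, μ.map_pow, ← hδ, ← WithTop.coe_nsmul]
    refine μ.map_lt_sum WithTop.coe_ne_top fun j hjk => ?_
    rw [← C_mul', map_C_mul_pow hμ hδ.symm]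
    by_cases hz : v (g.coeff j) = ⊤
    · rw [hz, top_add]; exact WithTop.coe_lt_top _
    · obtain ⟨β, hβ⟩ := WithTop.ne_top_iff_exists.1 hz
      have h := hj j
      rw [← hβ, ← WithTop.coe_add, WithTop.coe_le_coe] at h
      rw [← hβ, ← WithTop.coe_add, WithTop.coe_lt_coe]
      obtain ⟨i, hi⟩ := Nat.exists_eq_add_of_lt (Finset.mem_range.1 hjk)
      rw [hi, add_assoc, add_nsmul, add_comm β] at h ⊢
      exact add_lt_add_right ((nsmul_lt_nsmul_right i.succ_ne_zero hlt).trans_le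
        (le_of_add_le_add_left h)) _
  rw [hlow]
  exact hD.trans (inForm_dvd_of_dvd hdvd)

theorem map_lt_rootVal_self (hv : IsHenselianValued v)
    (hvbar : ∀ a : K, vbar (algebraMap K (AlgebraicClosure K) a) = v a)
    (hμ : ∀ a : K, μ (C a) = v a) (hQ : IsKeyPoly μ Q)
    (hFm : F.Monic) (hFi : Irreducible F) (hθ : aeval θ F = 0)
    (hD : inForm μ Q ∣ inForm μ F) : μ Q < rootVal vbar θ Q := by
  by_contra! hle
  obtain ⟨δ, hδ⟩ := hQ.exists_map_eq hQ.monic.ne_zero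
  obtain ⟨γ, hγ⟩ := WithTop.ne_top_iff_exists.1 (hle.trans_lt hQ.ne_top.lt_top).ne_top
  obtain ⟨h0, hj⟩ := map_coeff_minpoly hv hvbar (aeval θ Q) hγ.symm
  rw [← hγ, hδ, WithTop.coe_le_coe] at hle
  have hdvd := dvd_aeval_minpoly hFm hFi hθ Q
  set g := minpoly K (aeval θ Q)
  have hb0 : g.coeff 0 ≠ 0 := by
    intro h
    rw [h, v.map_zero] at h0
    exact WithTop.top_ne_coe h0
  have hval : μ (C (g.coeff 0)) ≤ μ (aeval Q g) := by
    rw [aeval_eq_sum_range, hμ, h0]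
    refine μ.map_le_sum fun j _ => ?_
    rw [← C_mul', map_C_mul_pow hμ hδ]
    refine (hj j).trans ?_
    gcongr
    exact WithTop.coe_le_coe.2 (nsmul_le_nsmul_right hle j)
  -- As `g(Q)` is `b_0` plus a multiple of `Q`, such an `s` raises the value of `b_0` by adding a
  -- multiple of `Q`, which `map_add_mul_le` forbids.
  obtain ⟨s, hs⟩ : ∃ s, μ (C (g.coeff 0)) < μ (aeval Q g - Q * s) := by
    by_cases hP : aeval Q g = 0
    · refine ⟨0, ?_⟩
      rw [hP, mul_zero, sub_zero, μ.map_zero, hμ, h0]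
      exact WithTop.coe_lt_top _
    · obtain ⟨s, hs⟩ := (hQ.dvd_iff hP).1 (hD.trans (inForm_dvd_of_dvd hdvd))
      exact ⟨s, hval.trans_lt hs⟩
  have hdeg : (C (g.coeff 0)).degree < Q.degree :=
    degree_C_le.trans_lt (natDegree_pos_iff_degree_pos.1 hQ.natDegree_pos)
  have h1 := hQ.map_add_mul_le hdeg (aeval Q g.divX - s)
  rw [mul_sub, ← add_sub_assoc] at h1
  have e : aeval Q g = C (g.coeff 0) + Q * aeval Q g.divX := by
    conv_lhs => rw [← divX_mul_X_add g]
    rw [map_add, map_mul, aeval_X, aeval_C, algebraMap_eq]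
    ring
  rw [← e] at h1
  exact hs.not_ge h1

theorem lt_rootVal_of_dvd (hQ : IsKeyPoly μ Q) (hle : ∀ f, μ f ≤ rootVal vbar θ f)
    (hlt : μ Q < rootVal vbar θ Q) {f : K[X]} (hf : f ≠ 0) (hD : inForm μ Q ∣ inForm μ f) :
    μ f < rootVal vbar θ f := by
  obtain ⟨s, hs⟩ := (hQ.dvd_iff hf).1 hD
  have h1 : μ f ≤ μ (Q * s) := by
    rw [show Q * s = f - (f - Q * s) by ring]
    exact μ.map_le_sub le_rfl hs.le
  rw [show f = Q * s + (f - Q * s) by ring]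
  conv_lhs => rw [← show f = Q * s + (f - Q * s) by ring]
  refine (rootVal vbar θ).map_lt_add ?_ (hs.trans_le (hle _))
  by_cases hz : s = 0
  · rw [hz, mul_zero, (rootVal vbar θ).map_zero]
    exact (hQ.map_ne_top hf).lt_top
  · refine h1.trans_lt ?_
    rw [μ.map_mul, (rootVal vbar θ).map_mul]
    calc μ Q + μ s < rootVal vbar θ Q + μ s := WithTop.add_lt_add_right (hQ.map_ne_top hz) hlt
      _ ≤ _ := by gcongr; exact hle _

theorem dvd_iff_tangentDir (hv : IsHenselianValued v)
    (hvbar : ∀ a : K, vbar (algebraMap K (AlgebraicClosure K) a) = v a)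
    (hμ : ∀ a : K, μ (C a) = v a) (hQ : IsKeyPoly μ Q)
    (hFm : F.Monic) (hFi : Irreducible F) (hθ : aeval θ F = 0) :
    inForm μ Q ∣ inForm μ F ↔
      ValLT μ (rootVal vbar θ) ∧ tangentDir μ (rootVal vbar θ) = keyClass μ Q := by
  constructor
  · intro hD
    have hle := rootVal_le hv hvbar hμ hQ hFm hFi hθ hD
    have hlt := map_lt_rootVal_self hv hvbar hμ hQ hFm hFi hθ hD
    refine ⟨⟨hle, fun e => ?_⟩, hQ.tangentDir_eq fun f hf => ⟨fun h => ?_, fun h => ?_⟩⟩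
    · exact hlt.ne (congrArg (fun w : AddValuation K[X] (WithTop Λ) => w Q) e)
    · exact dvd_of_lt_rootVal hv hvbar hμ hQ hFm hFi hθ hD h
    · exact lt_rootVal_of_dvd hQ hle hlt hf h
  · rintro ⟨⟨hle, -⟩, ht⟩
    refine hQ.dvd_of_tangentDir_eq hle (fun a => ?_) ht hFm.ne_zero
      ((rootVal_eq_top_iff F).2 hθ)
    rw [rootVal_apply, aeval_C, hvbar, hμ]

end RootValuation

/-! ### `Q`-expansions by iterated division -/

section Digits

variable {K : Type*} [Field K]

/-- The coefficients of the `Q`-expansion of `f`. -/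
def digit (Q : K[X]) : ℕ → K[X] → K[X]
  | 0, f => f %ₘ Q
  | n + 1, f => digit Q n (f /ₘ Q)

variable {Q : K[X]}

theorem degree_digit_lt (hQ : Q.Monic) (n : ℕ) (f : K[X]) : (digit Q n f).degree < Q.degree := by
  induction n generalizing f with
  | zero => exact degree_modByMonic_lt f hQ
  | succ n ih => exact ih _

theorem digit_zero_right (n : ℕ) : digit Q n 0 = 0 := by
  induction n with
  | zero => exact zero_modByMonic Q
  | succ n ih => rw [digit, zero_divByMonic, ih]

theorem add_divByMonic (f g : K[X]) : (f + g) /ₘ Q = f /ₘ Q + g /ₘ Q := by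
  by_cases hQ : Q.Monic
  · refine (div_modByMonic_unique (f /ₘ Q + g /ₘ Q) (f %ₘ Q + g %ₘ Q) hQ ⟨?_, ?_⟩).1
    · conv_rhs => rw [← modByMonic_add_div f Q, ← modByMonic_add_div g Q]
      ring
    · exact (degree_add_le _ _).trans_lt
        (max_lt (degree_modByMonic_lt _ hQ) (degree_modByMonic_lt _ hQ))
  · simp [divByMonic_eq_of_not_monic _ hQ]

theorem digit_add (n : ℕ) (f g : K[X]) : digit Q n (f + g) = digit Q n f + digit Q n g := by
  induction n generalizing f g with
  | zero => exact add_modByMonic f g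
  | succ n ih => rw [digit, digit, digit, add_divByMonic, ih]

theorem digit_sum {ι : Type*} (n : ℕ) (s : Finset ι) (f : ι → K[X]) :
    digit Q n (∑ i ∈ s, f i) = ∑ i ∈ s, digit Q n (f i) :=
  map_sum (AddMonoidHom.mk' (digit Q n) (digit_add n)) f s

theorem digit_mul_pow (hQ : Q.Monic) {a : K[X]} (ha : a.degree < Q.degree) (k n : ℕ) :
    digit Q n (a * Q ^ k) = if n = k then a else 0 := by
  induction k generalizing n with
  | zero =>
    rw [pow_zero, mul_one]
    rcases n with _ | n
    · rw [if_pos rfl, digit, (modByMonic_eq_self_iff hQ).2 ha]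
    · rw [if_neg n.succ_ne_zero, digit, (divByMonic_eq_zero_iff hQ).2 ha, digit_zero_right]
  | succ k ih =>
    rw [pow_succ, ← mul_assoc]
    rcases n with _ | n
    · rw [if_neg k.succ_ne_zero.symm, digit, (modByMonic_eq_zero_iff_dvd hQ).2 (dvd_mul_left _ _)]
    · rw [digit, mul_comm, mul_divByMonic_cancel_left _ hQ, ih]
      simp

/-- The alternative `f = 0` keeps the induction going when the quotient vanishes: no degree is below
`0 * deg Q`. -/
theorem sum_digit (hQ : Q.Monic) {N : ℕ} {f : K[X]} (h : f.natDegree < N * Q.natDegree ∨ f = 0) :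
    f = ∑ n ∈ Finset.range N, digit Q n f * Q ^ n := by
  induction N generalizing f with
  | zero => simpa using h
  | succ N ih =>
    have h' : f /ₘ Q = ∑ n ∈ Finset.range N, digit Q n (f /ₘ Q) * Q ^ n := by
      refine ih ?_
      rcases h with h | rfl
      · rcases lt_or_ge f.natDegree Q.natDegree with h2 | h2
        · right
          rw [divByMonic_eq_zero_iff hQ]
          exact degree_lt_degree h2
        · left
          rw [natDegree_divByMonic f hQ]
          rw [add_mul, one_mul] at h
          omega
      · right
        exact zero_divByMonic Q
    rw [Finset.sum_range_succ']
    conv_lhs => rw [← modByMonic_add_div f Q, h', Finset.mul_sum, add_comm]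
    congr 1
    · refine Finset.sum_congr rfl fun n _ => ?_
      rw [digit]
      ring
    · rw [pow_zero, mul_one, digit]

theorem digit_eq_zero (hQ : Q.Monic) {n : ℕ} {f : K[X]} (h : f.natDegree < n * Q.natDegree) :
    digit Q n f = 0 := by
  rw [sum_digit hQ (Or.inl h), digit_sum]
  refine Finset.sum_eq_zero fun i hi => ?_
  rw [digit_mul_pow hQ (degree_digit_lt hQ i f), if_neg (Finset.mem_range.1 hi).ne']

theorem digit_eq_one (hQ : Q.Monic) (hQ1 : 0 < Q.natDegree) {q : ℕ} {f : K[X]} (hf : f.Monic)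
    (h : f.natDegree = q * Q.natDegree) : digit Q q f = 1 := by
  induction q generalizing f with
  | zero =>
    rw [zero_mul] at h
    rw [hf.natDegree_eq_zero.1 h, digit, modByMonic_eq_self_iff hQ, degree_one]
    exact natDegree_pos_iff_degree_pos.1 hQ1
  | succ q ih =>
    rw [add_mul, one_mul] at h
    refine ih ?_ ?_
    · rw [Monic, leadingCoeff_divByMonic_of_monic hQ]
      · exact hf
      · rw [degree_eq_natDegree hQ.ne_zero, degree_eq_natDegree hf.ne_zero, h, Nat.cast_le]
        exact Nat.le_add_left _ _
    · rw [natDegree_divByMonic f hQ, h, Nat.add_sub_cancel]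

theorem digit_aeval (hQ : Q.Monic) (hQ1 : 0 < Q.natDegree) (g : K[X]) (n : ℕ) :
    digit Q n (aeval Q g) = C (g.coeff n) := by
  have hC : ∀ b : K, (C b).degree < Q.degree := fun b =>
    degree_C_le.trans_lt (natDegree_pos_iff_degree_pos.1 hQ1)
  rw [aeval_eq_sum_range, digit_sum]
  simp_rw [← C_mul', digit_mul_pow hQ (hC _)]
  rw [Finset.sum_ite_eq]
  split_ifs with h
  · rfl
  · rw [coeff_eq_zero_of_natDegree_lt, C_0]
    simpa using h

theorem IsExpansion.eq_digit (hQ : Q.Monic) {f : K[X]} {a : ℕ →₀ K[X]} (h : IsExpansion Q f a)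
    (n : ℕ) : a n = digit Q n f := by
  rw [h.2, Finsupp.sum, digit_sum]
  simp_rw [digit_mul_pow hQ (h.1 _)]
  rw [Finset.sum_ite_eq]
  split_ifs with hn
  · rfl
  · simpa using hn

theorem exists_isExpansion (hQ : Q.Monic) (hQ1 : 0 < Q.natDegree) (f : K[X]) :
    ∃ a : ℕ →₀ K[X], IsExpansion Q f a := by
  refine ⟨Finsupp.onFinset (Finset.range (f.natDegree + 1)) (fun n => digit Q n f)
    fun n hn => ?_, fun n => degree_digit_lt hQ n f, ?_⟩
  · by_contra h
    refine hn (digit_eq_zero hQ ?_)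
    rw [Finset.mem_range, not_lt] at h
    nlinarith
  · rw [Finsupp.onFinset_sum _ (by simp)]
    exact sum_digit hQ (Or.inl (by nlinarith))

end Digits

/-! ### The last index of minimal weight -/

section Leading

variable {K : Type*} [Field K]
variable {Λ : Type*} [AddCommGroup Λ] [LinearOrder Λ] [IsOrderedAddMonoid Λ]
variable {μ : AddValuation K[X] (WithTop Λ)} {Q : K[X]}

/-- Giving weight `γ` to `Q`, the terms of the `Q`-expansion of `f` have minimal weight `α`, which
is attained for the last time in degree `i`. -/
structure LeadsAt (μ : AddValuation K[X] (WithTop Λ)) (Q : K[X]) (γ : Λ) (f : K[X]) (i : ℕ)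
    (α : Λ) : Prop where
  eq : μ (digit Q i f) = (α - i • γ : Λ)
  le : ∀ n, ((α - n • γ : Λ) : WithTop Λ) ≤ μ (digit Q n f)
  lt : ∀ n, i < n → ((α - n • γ : Λ) : WithTop Λ) < μ (digit Q n f)

theorem LeadsAt.le_of_leadsAt {γ : Λ} {f : K[X]} {i j : ℕ} {α β : Λ} (h : LeadsAt μ Q γ f i α)
    (h' : LeadsAt μ Q γ f j β) : β ≤ α := by
  have := h'.le i
  rw [h.eq, WithTop.coe_le_coe] at this
  exact (sub_le_sub_iff_right _).1 this

theorem LeadsAt.unique {γ : Λ} {f : K[X]} {i j : ℕ} {α β : Λ} (h : LeadsAt μ Q γ f i α)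
    (h' : LeadsAt μ Q γ f j β) : i = j ∧ α = β := by
  obtain rfl := le_antisymm (h'.le_of_leadsAt h) (h.le_of_leadsAt h')
  refine ⟨?_, rfl⟩
  rcases lt_trichotomy i j with hij | hij | hij
  · exact absurd h'.eq (h.lt j hij).ne'
  · exact hij
  · exact absurd h.eq (h'.lt i hij).ne'

theorem exists_leadsAt (hQ : IsKeyPoly μ Q) (γ : Λ) {f : K[X]} (hf : f ≠ 0) :
    ∃ i α, LeadsAt μ Q γ f i α := by
  set N := f.natDegree + 1
  have hN : f.natDegree < N * Q.natDegree := by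
    have := hQ.natDegree_pos
    simp only [N]
    nlinarith
  have hbig : ∀ n, N ≤ n → digit Q n f = 0 := fun n hn =>
    digit_eq_zero hQ.monic (hN.trans_le (Nat.mul_le_mul_right _ hn))
  set w : ℕ → WithTop Λ := fun n => μ (digit Q n f) + (n • γ : Λ) with hw
  obtain ⟨i₀, -, hi₀⟩ := (Finset.range N).exists_min_image w ⟨0, by simp [N]⟩
  have hmin : ∀ n, w i₀ ≤ w n := fun n => by
    rcases lt_or_ge n N with h | h
    · exact hi₀ n (Finset.mem_range.2 h)
    · simp [hw, hbig n h]
  have htop : w i₀ ≠ ⊤ := by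
    intro h
    apply hf
    rw [sum_digit hQ.monic (Or.inl hN)]
    refine Finset.sum_eq_zero fun n _ => ?_
    have hn := hmin n
    rw [h, top_le_iff, WithTop.add_eq_top] at hn
    rw [hQ.eq_zero_of_map_eq_top (hn.resolve_right WithTop.coe_ne_top), zero_mul]
  obtain ⟨α, hα⟩ := WithTop.ne_top_iff_exists.1 htop
  have hlt : ∀ n, w n = α → n < N := fun n hn => by
    by_contra! h
    simp [hw, hbig n h] at hn
  classical
  have hP : ∃ i, w i = α ∧ ∀ n, w n = α → n ≤ i := by
    have h1 := Nat.findGreatest_spec (P := fun n => w n = α) (hlt i₀ hα.symm).le hα.symm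
    exact ⟨_, h1, fun n hn => Nat.le_findGreatest (hlt n hn).le hn⟩
  obtain ⟨i, hi, himax⟩ := hP
  have key : ∀ (n : ℕ) (x : WithTop Λ), ((α - n • γ : Λ) : WithTop Λ) ≤ x ↔
      (α : WithTop Λ) ≤ x + (n • γ : Λ) := fun n x => by
    induction x using WithTop.recTopCoe with
    | top => simp
    | coe x => rw [← WithTop.coe_add, WithTop.coe_le_coe, WithTop.coe_le_coe, sub_le_iff_le_add]
  have key' : ∀ (n : ℕ) (x : WithTop Λ), x = (α - n • γ : Λ) ↔ x + (n • γ : Λ) = α := fun n x => by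
    induction x using WithTop.recTopCoe with
    | top => exact iff_of_false WithTop.top_ne_coe (by rw [top_add]; exact WithTop.top_ne_coe)
    | coe x => rw [← WithTop.coe_add, WithTop.coe_eq_coe, WithTop.coe_eq_coe, eq_sub_iff_add_eq]
  have hle : ∀ n, ((α - n • γ : Λ) : WithTop Λ) ≤ μ (digit Q n f) := fun n => by
    rw [key, hα]
    exact hmin n
  exact ⟨i, α, (key' _ _).2 hi, hle, fun n hn => lt_of_le_of_ne (hle n) fun h =>
    (himax n ((key' _ _).1 h.symm)).not_gt hn⟩

/-- Write a product of two digits as `c + d * Q` with `c` and `d` reduced. Then `c` keeps the value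
of the product. The value of `d * Q` is at least as large, so, because `μ Q < γ`, the carry `d` into
the next digit has strictly larger weight. Up to higher weight, expansions therefore multiply
without carries. -/
theorem LeadsAt.mul (hQ : IsKeyPoly μ Q) {γ : Λ} (hγ : μ Q < γ) {f g : K[X]} {i j : ℕ} {α β : Λ}
    (hf : LeadsAt μ Q γ f i α) (hg : LeadsAt μ Q γ g j β) :
    LeadsAt μ Q γ (f * g) (i + j) (α + β) := by
  have hm := hQ.natDegree_pos
  have hdeg := fun n f => degree_digit_lt hQ.monic n f
  obtain ⟨ρ, hρ⟩ := hQ.exists_map_eq hQ.monic.ne_zero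
  rw [hρ, WithTop.coe_lt_coe] at hγ
  set p : ℕ × ℕ → K[X] := fun x => digit Q x.1 f * digit Q x.2 g with hp
  have hsub : ∀ s t : ℕ, α + β - (s + t) • γ = (α - s • γ) + (β - t • γ) := fun s t => by
    rw [add_nsmul]; abel
  have hple : ∀ x : ℕ × ℕ, ((α + β - (x.1 + x.2) • γ : Λ) : WithTop Λ) ≤ μ (p x) := fun x => by
    rw [hsub, WithTop.coe_add, hp, μ.map_mul]
    exact add_le_add (hf.le _) (hg.le _)
  have hplt : ∀ x : ℕ × ℕ, i < x.1 ∨ j < x.2 →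
      ((α + β - (x.1 + x.2) • γ : Λ) : WithTop Λ) < μ (p x) := fun x hx => by
    rw [hsub, WithTop.coe_add, hp, μ.map_mul]
    rcases hx with hx | hx
    · exact WithTop.add_lt_add_of_lt_of_le WithTop.coe_ne_top (hf.lt _ hx) (hg.le _)
    · exact WithTop.add_lt_add_of_le_of_lt WithTop.coe_ne_top (hf.le _) (hg.lt _ hx)
  have hc : ∀ x, μ (p x %ₘ Q) = μ (p x) := fun x => hQ.map_modByMonic_mul (hdeg _ _) (hdeg _ _)
  have hd : ∀ x : ℕ × ℕ,
      ((α + β - (x.1 + x.2 + 1) • γ : Λ) : WithTop Λ) < μ (p x /ₘ Q) := fun x => by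
    by_cases hz : p x /ₘ Q = 0
    · rw [hz, μ.map_zero]; exact WithTop.coe_lt_top _
    obtain ⟨δ, hδ⟩ := hQ.exists_map_eq hz
    have h := (hple x).trans (hQ.map_le_map_mul_divByMonic (p x))
    rw [μ.map_mul, hρ, hδ, ← WithTop.coe_add, WithTop.coe_le_coe] at h
    rw [hδ, WithTop.coe_lt_coe, succ_nsmul, ← sub_sub, sub_lt_iff_lt_add']
    exact h.trans_lt (add_lt_add_left hγ δ)
  have hddeg : ∀ x, (p x /ₘ Q).degree < Q.degree := fun x => by
    by_cases hz : p x /ₘ Q = 0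
    · rw [hz, degree_zero]
      exact bot_lt_iff_ne_bot.2 (degree_ne_bot.2 hQ.monic.ne_zero)
    refine degree_lt_degree ?_
    rw [natDegree_divByMonic _ hQ.monic]
    have h1 := natDegree_mul_le (p := digit Q x.1 f) (q := digit Q x.2 g)
    have h3 : (digit Q x.1 f).natDegree < Q.natDegree := by
      by_cases h0 : digit Q x.1 f = 0
      · simpa [h0] using hm
      · exact natDegree_lt_natDegree h0 (hdeg _ _)
    have h4 : (digit Q x.2 g).natDegree < Q.natDegree := by
      by_cases h0 : digit Q x.2 g = 0
      · simpa [h0] using hm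
      · exact natDegree_lt_natDegree h0 (hdeg _ _)
    simp only [hp]
    omega
  -- Large enough for the full expansion, and for the index `i` to lie in the range.
  set N := f.natDegree + i + 1
  set M := g.natDegree + j + 1
  -- The contribution of the pair `x` to the digit `n`: a remainder, or a carry from the digit
  -- below.
  set T : ℕ → ℕ × ℕ → K[X] := fun n x =>
    (if n = x.1 + x.2 then p x %ₘ Q else 0) + if n = x.1 + x.2 + 1 then p x /ₘ Q else 0 with hT
  have hdigit : ∀ n, digit Q n (f * g) = ∑ x ∈ Finset.range N ×ˢ Finset.range M, T n x := by
    intro n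
    have e : f * g = ∑ x ∈ Finset.range N ×ˢ Finset.range M,
        (p x %ₘ Q * Q ^ (x.1 + x.2) + p x /ₘ Q * Q ^ (x.1 + x.2 + 1)) := by
      conv_lhs => rw [sum_digit hQ.monic (N := N) (f := f) (Or.inl (by simp only [N]; nlinarith)),
        sum_digit hQ.monic (N := M) (f := g) (Or.inl (by simp only [M]; nlinarith)),
        Finset.sum_mul_sum, ← Finset.sum_product']
      refine Finset.sum_congr rfl fun x _ => ?_
      calc _ = p x * Q ^ (x.1 + x.2) := by simp only [hp]; ring
        _ = (p x %ₘ Q + Q * (p x /ₘ Q)) * Q ^ (x.1 + x.2) := by rw [modByMonic_add_div]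
        _ = _ := by ring
    rw [e, digit_sum]
    refine Finset.sum_congr rfl fun x _ => ?_
    rw [digit_add, digit_mul_pow hQ.monic (degree_modByMonic_lt _ hQ.monic),
      digit_mul_pow hQ.monic (hddeg x)]
  have hTlt : ∀ n x, (n = x.1 + x.2 → i < x.1 ∨ j < x.2) →
      ((α + β - n • γ : Λ) : WithTop Λ) < μ (T n x) := by
    intro n x hx
    refine μ.map_lt_add ?_ ?_
    · split_ifs with h
      · rw [hc, h]; exact hplt x (hx h)
      · rw [μ.map_zero]; exact WithTop.coe_lt_top _
    · split_ifs with h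
      · rw [h]; exact hd x
      · rw [μ.map_zero]; exact WithTop.coe_lt_top _
  have hTle : ∀ n x, ((α + β - n • γ : Λ) : WithTop Λ) ≤ μ (T n x) := by
    intro n x
    refine μ.map_le_add ?_ ?_
    · split_ifs with h
      · rw [hc, h]; exact hple x
      · rw [μ.map_zero]; exact le_top
    · split_ifs with h
      · rw [h]; exact (hd x).le
      · rw [μ.map_zero]; exact le_top
  refine ⟨?_, fun n => ?_, fun n hn => ?_⟩
  · have hmem : (i, j) ∈ Finset.range N ×ˢ Finset.range M := by
      simp [N, M]
    have hTij : μ (T (i + j) (i, j)) = (α + β - (i + j) • γ : Λ) := by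
      simp only [hT, if_true, if_neg (Nat.succ_ne_self (i + j)).symm, add_zero]
      rw [hc, hp, μ.map_mul, hf.eq, hg.eq, hsub, WithTop.coe_add]
    rw [hdigit, ← Finset.add_sum_erase _ _ hmem, ← hTij]
    refine μ.map_add_eq_of_lt_left ?_
    rw [hTij]
    -- Any other pair with sum `i + j` exceeds `i` or `j` in one coordinate, where the inequality is
    -- strict.
    refine μ.map_lt_sum WithTop.coe_ne_top fun x hx => hTlt _ x fun h => ?_
    by_contra! hle
    refine (Finset.mem_erase.1 hx).1 (Prod.ext ?_ ?_)
    · change x.1 = i; omega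
    · change x.2 = j; omega
  · rw [hdigit]
    exact μ.map_le_sum fun x _ => hTle n x
  · rw [hdigit]
    exact μ.map_lt_sum WithTop.coe_ne_top fun x _ => hTlt n x fun h => by omega

theorem LeadsAt.mul_le_natDegree (hQ : IsKeyPoly μ Q) {γ : Λ} {f : K[X]} {i : ℕ} {α : Λ}
    (h : LeadsAt μ Q γ f i α) : i * Q.natDegree ≤ f.natDegree := by
  by_contra! hlt
  have := h.eq
  rw [digit_eq_zero hQ.monic hlt, μ.map_zero] at this
  exact WithTop.top_ne_coe this

theorem LeadsAt.eq_nsmul (hQ : IsKeyPoly μ Q) {γ : Λ} {f : K[X]} {i : ℕ} {α : Λ}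
    (h : LeadsAt μ Q γ f i α) (hf : f.Monic) (hd : f.natDegree = i * Q.natDegree) :
    α = i • γ := by
  have := h.eq
  rw [digit_eq_one hQ.monic hQ.natDegree_pos hf hd, μ.map_one, ← WithTop.coe_zero,
    WithTop.coe_eq_coe] at this
  exact sub_eq_zero.1 this.symm

end Leading

/-! ### The `Q`-expansion of `F` -/

section MainExpansion

variable {K : Type*} [Field K]
variable {Λ : Type*} [AddCommGroup Λ] [LinearOrder Λ] [IsOrderedAddMonoid Λ]
variable {v : AddValuation K (WithTop Λ)} {vbar : AddValuation (AlgebraicClosure K) (WithTop Λ)}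
variable {μ : AddValuation K[X] (WithTop Λ)} {Q F : K[X]} {θ : AlgebraicClosure K}

theorem exists_digit_bounds (hv : IsHenselianValued v)
    (hvbar : ∀ a : K, vbar (algebraMap K (AlgebraicClosure K) a) = v a)
    (hμ : ∀ a : K, μ (C a) = v a) (hQ : IsKeyPoly μ Q)
    (hFm : F.Monic) (hFi : Irreducible F) (hθ : aeval θ F = 0)
    (hD : inForm μ Q ∣ inForm μ F) (hne : F ≠ Q) :
    ∃ (γ : Λ) (l : ℕ), rootVal vbar θ Q = γ ∧ μ Q < γ ∧ F.natDegree = l * Q.natDegree ∧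
      digit Q l F = 1 ∧ μ (digit Q 0 F) = (l • γ : Λ) ∧
      ∀ n, ((l • γ - n • γ : Λ) : WithTop Λ) ≤ μ (digit Q n F) := by
  have hm := hQ.natDegree_pos
  -- An infinite value means `F ∣ Q`, while minimality gives `deg Q ≤ deg F`.
  have htop : rootVal vbar θ Q ≠ ⊤ := fun h =>
    hne (eq_of_monic_of_dvd_of_natDegree_le hFm hQ.monic
      (dvd_of_aeval_eq_zero hFm hFi hθ ((rootVal_eq_top_iff Q).1 h))
      (hQ.minimal F hFm.ne_zero hD)).symm
  obtain ⟨γ, hγ⟩ := WithTop.ne_top_iff_exists.1 htop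
  have hlt : μ Q < γ := hγ ▸ map_lt_rootVal_self hv hvbar hμ hQ hFm hFi hθ hD
  obtain ⟨h0, hj⟩ := map_coeff_minpoly hv hvbar (aeval θ Q) hγ.symm
  obtain ⟨H, hH⟩ := dvd_aeval_minpoly hFm hFi hθ Q
  have hgm : (minpoly K (aeval θ Q)).Monic := minpoly.monic (Algebra.IsIntegral.isIntegral _)
  set g := minpoly K (aeval θ Q)
  have hPm : (aeval Q g).Monic := by
    rw [← comp_eq_aeval]
    exact hgm.comp hQ.monic hm.ne'
  have hPd : (aeval Q g).natDegree = g.natDegree * Q.natDegree := by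
    rw [← comp_eq_aeval, natDegree_comp]
  have hHm : H.Monic := hFm.of_mul_monic_left (hH ▸ hPm)
  have hPlead : LeadsAt μ Q γ (aeval Q g) g.natDegree (g.natDegree • γ) := by
    refine ⟨?_, fun n => ?_, fun n hn => ?_⟩
    · rw [digit_aeval hQ.monic hm, hgm.coeff_natDegree, C_1, μ.map_one, sub_self, WithTop.coe_zero]
    · rw [digit_aeval hQ.monic hm, hμ]
      have h := hj n
      generalize v (g.coeff n) = x at h ⊢
      induction x using WithTop.recTopCoe with
      | top => exact le_top
      | coe x =>
        rw [← WithTop.coe_add, WithTop.coe_le_coe] at h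
        exact WithTop.coe_le_coe.2 (sub_le_iff_le_add.2 h)
    · rw [digit_aeval hQ.monic hm, coeff_eq_zero_of_natDegree_lt hn, C_0, μ.map_zero]
      exact WithTop.coe_lt_top _
  obtain ⟨l, α, hFl⟩ := exists_leadsAt hQ γ hFm.ne_zero
  obtain ⟨l', β, hHl⟩ := exists_leadsAt hQ γ hHm.ne_zero
  obtain ⟨hl, hαβ⟩ := (hH ▸ hPlead).unique (hFl.mul hQ hlt hHl)
  have hFd := hFl.mul_le_natDegree hQ
  have hHd := hHl.mul_le_natDegree hQ
  rw [hH, hFm.natDegree_mul hHm, hl, add_mul] at hPd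
  -- Both degree bounds are equalities, since their sum is the degree of `g(Q) = F * H`.
  have hFd' : F.natDegree = l * Q.natDegree := by omega
  have hHd' : H.natDegree = l' * Q.natDegree := by omega
  obtain rfl := hFl.eq_nsmul hQ hFm hFd'
  obtain rfl := hHl.eq_nsmul hQ hHm hHd'
  refine ⟨γ, l, hγ.symm, hlt, hFd', digit_eq_one hQ.monic hm hFm hFd', ?_, hFl.le⟩
  have hF0 := hFl.le 0
  have hH0 := hHl.le 0
  -- The product of the constant digits reduces modulo `Q` to the constant digit `b_0` of `g(Q)`,
  -- without change of value. Each summand has its own lower bound, so both bounds are attained.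
  have hP0 : μ (digit Q 0 F) + μ (digit Q 0 H) = (l • γ + l' • γ : Λ) := by
    rw [← μ.map_mul, ← hQ.map_modByMonic_mul (degree_digit_lt hQ.monic _ _)
      (degree_digit_lt hQ.monic _ _), digit, digit, ← mul_modByMonic, ← hH, ← hαβ, ← h0, ← hμ,
      ← digit_aeval hQ.monic hm, digit]
  rw [zero_smul, sub_zero] at hF0 hH0
  generalize μ (digit Q 0 F) = x at *
  generalize μ (digit Q 0 H) = y at *
  induction x using WithTop.recTopCoe with
  | top => exact absurd hP0 WithTop.top_ne_coe
  | coe x =>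
    induction y using WithTop.recTopCoe with
    | top => exact absurd hP0 WithTop.top_ne_coe
    | coe y =>
      rw [← WithTop.coe_add, WithTop.coe_eq_coe] at hP0
      rw [WithTop.coe_le_coe] at hF0 hH0
      refine WithTop.coe_eq_coe.2 (le_antisymm (not_lt.1 fun h => ?_) hF0)
      exact (add_lt_add_of_lt_of_le h hH0).ne hP0.symm

/-- For `n < l` the `n`-th term has value at least `(l - n)γ + nμ(Q)`, which exceeds `lμ(Q)`. -/
theorem muEquiv_pow_of_digit_bounds (hQ : IsKeyPoly μ Q) {γ : Λ} {l : ℕ} (hγ : μ Q < γ)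
    (hd : F.natDegree = l * Q.natDegree) (hl : digit Q l F = 1)
    (hle : ∀ n, ((l • γ - n • γ : Λ) : WithTop Λ) ≤ μ (digit Q n F)) : MuEquiv μ F (Q ^ l) := by
  have hm := hQ.natDegree_pos
  have h : MuEquiv μ (Q ^ l) F := by
    obtain ⟨ρ, hρ⟩ := hQ.exists_map_eq hQ.monic.ne_zero
    rw [hρ, WithTop.coe_lt_coe] at hγ
    rw [muEquiv_iff, ← μ.map_sub_swap]
    conv_rhs => rw [sum_digit hQ.monic (N := l + 1) (f := F) (Or.inl (by rw [hd, add_mul]; omega)),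
      Finset.sum_range_succ, hl, one_mul, add_sub_cancel_right]
    rw [μ.map_pow, hρ, ← WithTop.coe_nsmul]
    refine μ.map_lt_sum WithTop.coe_ne_top fun n hn => ?_
    rw [μ.map_mul, μ.map_pow, hρ, ← WithTop.coe_nsmul]
    refine lt_of_lt_of_le ?_ (add_le_add_left (hle n) _)
    rw [← WithTop.coe_add, WithTop.coe_lt_coe]
    obtain ⟨i, rfl⟩ := Nat.exists_eq_add_of_lt (Finset.mem_range.1 hn)
    rw [add_assoc, add_nsmul _ n, add_nsmul _ n, add_sub_cancel_left, add_comm]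
    exact add_lt_add_left (nsmul_lt_nsmul_right i.succ_ne_zero hγ) _
  exact ⟨h.2.1, h.1, h.2.2.symm⟩

end MainExpansion

/-! ### Convex hulls in `ℚ × Λ` -/

section LowerHull

variable {Λ : Type*} [AddCommGroup Λ] [LinearOrder Λ] [Module ℚ Λ]

theorem lowerHull_singleton (p : ℚ × Λ) : lowerHull {p} = {p} := by
  ext q
  simp only [lowerHull, convexHull_singleton, Set.mem_ofPred_eq, Set.mem_singleton_iff]
  constructor
  · exact fun h => h.1
  · rintro rfl
    exact ⟨rfl, fun β hβ => (congrArg Prod.snd hβ).ge⟩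

theorem isOneSided_segment {l : ℚ} (hl : 0 < l) (γ : Λ) :
    IsOneSided {p : ℚ × Λ | 0 ≤ p.1 ∧ p.1 ≤ l ∧ p.2 + p.1 • γ = l • γ} γ ∧
      HasLength {p : ℚ × Λ | 0 ≤ p.1 ∧ p.1 ≤ l ∧ p.2 + p.1 • γ = l • γ} l := by
  set N := {p : ℚ × Λ | 0 ≤ p.1 ∧ p.1 ≤ l ∧ p.2 + p.1 • γ = l • γ}
  have hN : N = component N γ := by
    ext p
    exact ⟨fun hp => ⟨hp, fun q hq => (hp.2.2.trans hq.2.2.symm).le⟩, fun hp => hp.1⟩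
  have hlen : HasLength N l :=
    ⟨⟨(l, 0), ⟨hl.le, le_rfl, zero_add _⟩, rfl⟩, by rintro _ ⟨p, hp, rfl⟩; exact hp.2.1⟩
  refine ⟨⟨hN, ?_, l, hl, ?_⟩, hlen⟩
  · rw [← hN]
    exact ⟨⟨(0, l • γ), ⟨le_rfl, hl.le, by simp⟩, rfl⟩, by rintro _ ⟨p, hp, rfl⟩; exact hp.1⟩
  · rw [← hN]
    exact hlen

variable [IsOrderedAddMonoid Λ]

theorem rat_smul_nonneg {q : ℚ} (hq : 0 ≤ q) {x : Λ} (hx : 0 ≤ x) : 0 ≤ q • x := by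
  by_contra! h
  have h1 : q.den • (q • x) < 0 := nsmul_neg h q.den_nz
  have h2 : q.den • (q • x) = q.num.toNat • x := by
    rw [← Nat.cast_smul_eq_nsmul ℚ, ← Nat.cast_smul_eq_nsmul ℚ, smul_smul]
    congr 1
    rw [Rat.den_mul_eq_num]
    exact_mod_cast (Int.toNat_of_nonneg (Rat.num_nonneg.2 hq)).symm
  rw [h2] at h1
  exact h1.not_ge (nsmul_nonneg hx _)

/-- The lower hull of points on or above a line, two of which lie on it at the extreme abscissas,
is a segment. -/
theorem lowerHull_eq_segment {S : Set (ℚ × Λ)} {l : ℚ} (hl : 0 < l) (γ : Λ)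
    (hS : ∀ p ∈ S, 0 ≤ p.1 ∧ p.1 ≤ l ∧ l • γ ≤ p.2 + p.1 • γ)
    (h0 : ((0 : ℚ), l • γ) ∈ S) (h1 : (l, (0 : Λ)) ∈ S) :
    lowerHull S = {p | 0 ≤ p.1 ∧ p.1 ≤ l ∧ p.2 + p.1 • γ = l • γ} := by
  have hhull : ∀ p ∈ convexHull ℚ S, 0 ≤ p.1 ∧ p.1 ≤ l ∧ l • γ ≤ p.2 + p.1 • γ := by
    refine convexHull_min (t := {p : ℚ × Λ | 0 ≤ p.1 ∧ p.1 ≤ l ∧ l • γ ≤ p.2 + p.1 • γ}) hS ?_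
    rintro p ⟨hp0, hp1, hp2⟩ q ⟨hq0, hq1, hq2⟩ a b ha hb hab
    refine ⟨?_, ?_, ?_⟩
    · simp only [Prod.fst_add, Prod.smul_fst, smul_eq_mul]
      positivity
    · simp only [Prod.fst_add, Prod.smul_fst, smul_eq_mul]
      calc a * p.1 + b * q.1 ≤ a * l + b * l := by gcongr
        _ = l := by rw [← add_mul, hab, one_mul]
    · have h1 := rat_smul_nonneg ha (sub_nonneg.2 hp2)
      have h2 := rat_smul_nonneg hb (sub_nonneg.2 hq2)
      have h3 := add_nonneg h1 h2
      rw [← sub_nonneg]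
      convert h3 using 1
      obtain rfl : b = 1 - a := by linarith
      simp only [Prod.fst_add, Prod.smul_fst, Prod.snd_add, Prod.smul_snd, smul_eq_mul]
      module
  -- The segment is swept by the convex combinations of its endpoints with weights `(l - t) / l` and
  -- `t / l`.
  have hseg : ∀ t : ℚ, 0 ≤ t → t ≤ l → (t, (l - t) • γ) ∈ convexHull ℚ S := by
    intro t ht0 htl
    have h := convex_convexHull ℚ S (subset_convexHull ℚ S h0) (subset_convexHull ℚ S h1)
      (a := (l - t) / l) (b := t / l) (div_nonneg (by linarith) hl.le) (by positivity)
      (by field_simp; ring)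
    convert h using 1
    ext
    · simp only [Prod.fst_add, Prod.smul_fst, smul_eq_mul]
      field_simp
      ring
    · simp only [Prod.snd_add, Prod.smul_snd, smul_zero, add_zero, smul_smul]
      congr 1
      field_simp
  ext p
  constructor
  · rintro ⟨hp, hmin⟩
    obtain ⟨hp0, hp1, hp2⟩ := hhull p hp
    refine ⟨hp0, hp1, le_antisymm ?_ hp2⟩
    have h := hmin _ (hseg p.1 hp0 hp1)
    calc p.2 + p.1 • γ ≤ (l - p.1) • γ + p.1 • γ := by gcongr
      _ = l • γ := by module
  · rintro ⟨hp0, hp1, hp2⟩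
    constructor
    · convert hseg p.1 hp0 hp1 using 1
      ext
      · rfl
      · rw [sub_smul, ← hp2, add_sub_cancel_right]
    · intro β hβ
      have h := (hhull _ hβ).2.2
      rw [← hp2] at h
      exact le_of_add_le_add_right h

end LowerHull

/-! ### Newton polygons read off from digits -/

section NewtonPolygons

variable {K : Type*} [Field K]
variable {Λ : Type*} [AddCommGroup Λ] [LinearOrder Λ] [IsOrderedAddMonoid Λ]

theorem mem_newtonPoints_iff {μ : AddValuation K[X] (WithTop Λ)} {Q f : K[X]} (hQ : Q.Monic)
    (hQ1 : 0 < Q.natDegree) {p : ℚ × Λ} :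
    p ∈ newtonPoints μ Q f ↔ ∃ n : ℕ, digit Q n f ≠ 0 ∧ p.1 = n ∧ μ (digit Q n f) = p.2 := by
  constructor
  · rintro ⟨a, ha, n, h⟩
    rw [ha.eq_digit hQ] at h
    exact ⟨n, h⟩
  · rintro ⟨n, h⟩
    obtain ⟨a, ha⟩ := exists_isExpansion hQ hQ1 f
    rw [← ha.eq_digit hQ] at h
    exact ⟨a, ha, n, h⟩

/-- The case `F = Q`: the polygon is a single point of abscissa `1`, so it has length `1` but is not
one-sided. -/
theorem newtonPoints_self {μ : AddValuation K[X] (WithTop Λ)} {Q : K[X]} (hQ : Q.Monic)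
    (hQ1 : 0 < Q.natDegree) : newtonPoints μ Q Q = {((1 : ℚ), (0 : Λ))} := by
  have hd : ∀ n, digit Q n Q = if n = 1 then 1 else 0 := fun n => by
    have h := digit_mul_pow hQ (a := 1)
      (by rw [degree_one]; exact natDegree_pos_iff_degree_pos.1 hQ1) 1 n
    rwa [pow_one, one_mul] at h
  ext ⟨x, y⟩
  rw [mem_newtonPoints_iff hQ hQ1, Set.mem_singleton_iff, Prod.mk.injEq]
  constructor
  · rintro ⟨n, h0, h1, h2⟩
    rw [hd] at h0 h2
    obtain rfl : n = 1 := by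
      by_contra h
      exact h0 (if_neg h)
    rw [if_pos rfl, μ.map_one, ← WithTop.coe_zero, WithTop.coe_eq_coe] at h2
    exact ⟨by simpa using h1, h2.symm⟩
  · rintro ⟨rfl, rfl⟩
    refine ⟨1, ?_, by simp, ?_⟩
    · simp [hd]
    · simp [hd]

variable [Module ℚ Λ]

theorem newtonPolygon_eq_segment {μ : AddValuation K[X] (WithTop Λ)} {Q F : K[X]} (hQ : Q.Monic)
    (hQ1 : 0 < Q.natDegree) {γ : Λ} {l : ℕ} (hl : 0 < l) (hd : F.natDegree = l * Q.natDegree)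
    (hFl : digit Q l F = 1) (hF0 : μ (digit Q 0 F) = (l • γ : Λ)) (hF0' : digit Q 0 F ≠ 0)
    (hle : ∀ n, ((l • γ - n • γ : Λ) : WithTop Λ) ≤ μ (digit Q n F)) :
    newtonPolygon μ Q F = {p | 0 ≤ p.1 ∧ p.1 ≤ (l : ℚ) ∧ p.2 + p.1 • γ = (l : ℚ) • γ} := by
  refine lowerHull_eq_segment (Nat.cast_pos.2 hl) γ ?_ ?_ ?_
  · rintro ⟨x, y⟩ hp
    obtain ⟨n, hn0, h1, h2⟩ := (mem_newtonPoints_iff hQ hQ1).1 hp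
    simp only at h1 h2
    subst h1
    refine ⟨Nat.cast_nonneg n, Nat.cast_le.2 (not_lt.1 fun h => hn0 (digit_eq_zero hQ ?_)), ?_⟩
    · rw [hd]
      gcongr
    · have h := hle n
      rw [h2, WithTop.coe_le_coe, sub_le_iff_le_add] at h
      simpa only [Nat.cast_smul_eq_nsmul] using h
  · refine (mem_newtonPoints_iff hQ hQ1).2 ⟨0, hF0', by simp, ?_⟩
    rw [hF0, Nat.cast_smul_eq_nsmul]
  · refine (mem_newtonPoints_iff hQ hQ1).2 ⟨l, by simp [hFl], rfl, by simp [hFl]⟩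

end NewtonPolygons

end ValPoly

end

/-! ### The main theorem -/

theorem mainTheorem4 {K : Type*} [Field K]
    {Λ : Type*} [AddCommGroup Λ] [LinearOrder Λ] [IsOrderedAddMonoid Λ] [Module ℚ Λ]
    (v : AddValuation K (WithTop Λ)) (hv : ValPoly.IsHenselianValued v)
    (vbar : AddValuation (AlgebraicClosure K) (WithTop Λ))
    (hvbar : ∀ a : K, vbar (algebraMap K (AlgebraicClosure K) a) = v a)
    (μ : AddValuation (Polynomial K) (WithTop Λ))
    (hμ : ∀ a : K, μ (Polynomial.C a) = v a)
    (Q : Polynomial K) (hQ : ValPoly.IsKeyPoly μ Q)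
    (F : Polynomial K) (hFmonic : F.Monic) (hFirr : Irreducible F)
    (θ : AlgebraicClosure K) (hθ : Polynomial.aeval θ F = 0) :
    (ValPoly.inForm μ Q ∣ ValPoly.inForm μ F ↔
      ValPoly.ValLT μ (ValPoly.rootVal vbar θ) ∧
        ValPoly.tangentDir μ (ValPoly.rootVal vbar θ) = ValPoly.keyClass μ Q) ∧
    (ValPoly.inForm μ Q ∣ ValPoly.inForm μ F →
      (F = Q ∨ ∃ γ : Λ, ValPoly.rootVal vbar θ Q = (γ : WithTop Λ) ∧
        ValPoly.IsOneSided (ValPoly.newtonPolygon μ Q F) γ) ∧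
      ∃ l : ℕ, ValPoly.HasLength (ValPoly.newtonPolygon μ Q F) (l : ℚ) ∧
        F.natDegree = l * Q.natDegree ∧
        ValPoly.MuEquiv μ F (Q ^ l)) := by
  refine ⟨ValPoly.dvd_iff_tangentDir hv hvbar hμ hQ hFmonic hFirr hθ, fun hD => ?_⟩
  have hm := hQ.natDegree_pos
  by_cases hFQ : F = Q
  · subst hFQ
    refine ⟨Or.inl rfl, 1, ?_, (one_mul _).symm, ?_⟩
    · rw [ValPoly.newtonPolygon, ValPoly.newtonPoints_self hQ.monic hm,
        ValPoly.lowerHull_singleton]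
      simp [ValPoly.HasLength]
    · rw [pow_one]
      exact ⟨hQ.ne_top, hQ.ne_top, rfl⟩
  · obtain ⟨γ, l, hγ, hlt, hd, hFl, hF0, hle⟩ :=
      ValPoly.exists_digit_bounds hv hvbar hμ hQ hFmonic hFirr hθ hD hFQ
    have hl : 0 < l := by
      rw [Nat.pos_iff_ne_zero]
      rintro rfl
      exact hFirr.natDegree_pos.ne' (hd.trans (zero_mul _))
    have hF0' : ValPoly.digit Q 0 F ≠ 0 := by
      intro h
      rw [h, μ.map_zero] at hF0
      exact WithTop.top_ne_coe hF0
    rw [ValPoly.newtonPolygon_eq_segment hQ.monic hm hl hd hFl hF0 hF0' hle]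
    obtain ⟨h1, h2⟩ := ValPoly.isOneSided_segment (Nat.cast_pos.2 hl) γ
    exact ⟨Or.inr ⟨γ, hγ, h1⟩, l, h2, hd,
      ValPoly.muEquiv_pow_of_digit_bounds hQ hlt hd hFl hle⟩
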